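/- Let $G$ be a finite group and let $\Sigma$ be a closed (compact, connected, without boundary) orientable topological surface of genus $g\ge 0$, that is, a space homeomorphic to the sphere if $g=0$ and to the connected sum of $g$ tori (equivalently, to the quotient of a $4g$-gon by the side identifications with boundary word $a_1b_1a_1^{-1}b_1^{-1}\cdots a_gb_ga_g^{-1}b_g^{-1}$) if $g\ge 1$. Let $\operatorname{Hom}(\pi_1(\Sigma),G)/\operatorname{Ad}G$ be the set of homomorphisms from the fundamental group of $\Sigma$ (at any base point) to $G$, modulo conjugation by elements of $G$. For a finite group $H$ let $\widehat H$ be the set of isomorphism classes of irreducible finite-dimensional complex representations of $H$, and let $\zeta_H(s)=\sum_{\pi\in\widehat H}(\dim\pi)^{-s}$ for $s\in\mathbb C$. Let $D(G)$ be the Drinfeld (quantum) double of $G$; as an algebra it is the complex algebra with basis $\delta_h\otimes x$ ($h,x\in G$), product $(\delta_h\otimes x)(\delta_k\otimes y)=\delta_{h,\,xkx^{-1}}\,\delta_h\otimes xy$ and unit $\sum_{h\in G}\delta_h\otimes 1$. Let $\zeta_{D(G)}(s)=\sum_{\Pi\in\widehat{D(G)}}(\dim\Pi)^{-s}$, where $\widehat{D(G)}$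 is the set of isomorphism classes of irreducible finite-dimensional complex representations of $D(G)$. For $k\in G$ let $C(k)$ be the centralizer of $k$ in $G$. Let $G/\operatorname{Ad}G$ be the set of conjugacy classes of $G$, let $\iota:G/\operatorname{Ad}G\to G$ be any choice of a representative $\iota(O)\in O$ of every conjugacy class $O$, and put $C_\iota(O)=C(\iota(O))$. Then $$\bigl|\operatorname{Hom}(\pi_1(\Sigma),G)/\operatorname{Ad}G\bigr|=\sum_{k\in G}\frac{|C(k)|}{|G|}\,|C(k)|^{2g-2}\,\zeta_{C(k)}(2g-2)=\sum_{O\in G/\operatorname{Ad}G}|C_\iota(O)|^{2g-2}\,\zeta_{C_\iota(O)}(2g-2)=|G|^{2g-2}\,\zeta_{D(G)}(2g-2).$$ -/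

import Mathlib

/-! ### Closed orientable surfaces -/

/-- The closed unit disc, thought of as a polygon with `4 g` sides. -/
abbrev ClosedDisc : Type := Metric.closedBall (0 : ℂ) 1

/-- The point of the boundary circle at angle `2 π t / (4 g)`: for `k < 4 g` the `k`-th side of the
`4 g`-gon consists of the points with `k ≤ t ≤ k + 1`. -/
noncomputable def polygonBoundary (g : ℕ) (t : ℝ) : ClosedDisc :=
  ⟨Complex.exp ((2 * Real.pi * t / (4 * g) : ℝ) * Complex.I), by
    rw [mem_closedBall_zero_iff, Complex.norm_exp_ofReal_mul_I]⟩

/-- The side identifications of the `4 g`-gon with boundary word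
`a₁ b₁ a₁⁻¹ b₁⁻¹ ⋯ a_g b_g a_g⁻¹ b_g⁻¹`. For `g = 0` there are no sides
and the whole boundary circle is collapsed to one point, which gives the sphere. -/
inductive SurfaceRel (g : ℕ) : ClosedDisc → ClosedDisc → Prop
  | a (i : Fin g) (t : ℝ) (ht : t ∈ Set.Icc (0 : ℝ) 1) :
      SurfaceRel g (polygonBoundary g (4 * (i : ℕ) + t)) (polygonBoundary g (4 * (i : ℕ) + 3 - t))
  | b (i : Fin g) (t : ℝ) (ht : t ∈ Set.Icc (0 : ℝ) 1) :
      SurfaceRel g (polygonBoundary g (4 * (i : ℕ) + 1 + t))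
        (polygonBoundary g (4 * (i : ℕ) + 4 - t))
  | sphere (hg : g = 0) (z w : ClosedDisc) (hz : ‖(z : ℂ)‖ = 1) (hw : ‖(w : ℂ)‖ = 1) :
      SurfaceRel g z w

/-- The standard closed orientable surface of genus `g` (the sphere for `g = 0`, the connected sum
of `g` tori for `g ≥ 1`), with the quotient topology. -/
abbrev StandardSurface (g : ℕ) : Type := Quot (SurfaceRel g)

/-- `S` is a closed (compact, connected, without boundary) orientable topological surface of
genus `g`. -/
def IsClosedOrientableSurface (g : ℕ) (S : Type*) [TopologicalSpace S] : Prop :=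
  Nonempty (S ≃ₜ StandardSurface g)

/-! ### The set `Hom(Γ, G) / Ad G` -/

/-- Two homomorphisms are equivalent when they are conjugate by an element of the target. -/
def homConjSetoid (Γ G : Type*) [Group Γ] [Group G] : Setoid (Γ →* G) where
  r φ ψ := ∃ h : G, ∀ γ : Γ, ψ γ = h * φ γ * h⁻¹
  iseqv :=
    { refl := fun _ => ⟨1, by simp⟩
      symm := by
        rintro φ ψ ⟨h, hh⟩
        exact ⟨h⁻¹, fun γ => by rw [hh]; group⟩
      trans := by
        rintro φ ψ χ ⟨h, hh⟩ ⟨k, hk⟩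
        exact ⟨k * h, fun γ => by rw [hk, hh]; group⟩ }

/-- The set `Hom(Γ, G) / Ad G`. -/
abbrev HomModConj (Γ G : Type*) [Group Γ] [Group G] := Quotient (homConjSetoid Γ G)

/-! ### The zeta function of a finite group -/

/-- Irreducible complex representations of `G` on the spaces `ℂⁿ`. Every finite-dimensional complex
representation is isomorphic to one on some `ℂⁿ`. -/
structure GroupIrrep (G : Type*) [Group G] where
  /-- the dimension -/
  dim : ℕ
  /-- the representation -/
  rep : Representation ℂ G (Fin dim → ℂ)
  irreducible : rep.IsIrreducible

/-- Isomorphism of representations. -/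
def groupIrrepSetoid (G : Type*) [Group G] : Setoid (GroupIrrep G) where
  r π σ := Nonempty (π.rep.Equiv σ.rep)
  iseqv :=
    { refl := fun _ => ⟨.refl _⟩
      symm := fun ⟨e⟩ => ⟨e.symm⟩
      trans := fun ⟨e⟩ ⟨f⟩ => ⟨e.trans f⟩ }

/-- The set `Ĝ` of isomorphism classes of irreducible finite-dimensional complex representations. -/
abbrev GroupDual (G : Type*) [Group G] := Quotient (groupIrrepSetoid G)

/-- The dimension of an isomorphism class of representations. -/
def GroupDual.dim {G : Type*} [Group G] : GroupDual G → ℕ :=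
  Quotient.lift GroupIrrep.dim (by
    rintro π σ ⟨e⟩
    simpa using e.toLinearEquiv.finrank_eq)

/-- `ζ_G(s) = ∑_{π ∈ Ĝ} 1 / (dim π)^s`. -/
noncomputable def groupZeta (G : Type*) [Group G] (s : ℂ) : ℂ :=
  ∑' π : GroupDual G, 1 / (π.dim : ℂ) ^ s

/-! ### The zeta function of a finite-dimensional algebra -/

/-- Irreducible complex representations of the algebra `A` on the spaces `ℂⁿ`. -/
structure AlgIrrep (A : Type*) [Ring A] [Algebra ℂ A] where
  /-- the dimension -/
  dim : ℕ
  /-- the representation -/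
  rep : A →ₐ[ℂ] Module.End ℂ (Fin dim → ℂ)
  dim_pos : 0 < dim
  irreducible : ∀ W : Submodule ℂ (Fin dim → ℂ),
    (∀ a : A, ∀ v ∈ W, rep a v ∈ W) → W = ⊥ ∨ W = ⊤

/-- Isomorphism of representations. -/
def algIrrepSetoid (A : Type*) [Ring A] [Algebra ℂ A] : Setoid (AlgIrrep A) where
  r π σ := ∃ e : (Fin π.dim → ℂ) ≃ₗ[ℂ] (Fin σ.dim → ℂ), ∀ a v, e (π.rep a v) = σ.rep a (e v)
  iseqv :=
    { refl := fun _ => ⟨.refl _ _, fun _ _ => rfl⟩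
      symm := by
        rintro π σ ⟨e, he⟩
        exact ⟨e.symm, fun a v => by rw [LinearEquiv.symm_apply_eq, he, e.apply_symm_apply]⟩
      trans := by
        rintro π σ τ ⟨e, he⟩ ⟨f, hf⟩
        exact ⟨e.trans f, fun a v => by simp [he, hf]⟩ }

/-- The set of isomorphism classes of irreducible finite-dimensional representations of `A`. -/
abbrev AlgDual (A : Type*) [Ring A] [Algebra ℂ A] := Quotient (algIrrepSetoid A)

/-- The dimension of an isomorphism class of representations. -/
def AlgDual.dim {A : Type*} [Ring A] [Algebra ℂ A] : AlgDual A → ℕ :=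
  Quotient.lift AlgIrrep.dim (by
    rintro π σ ⟨e, -⟩
    simpa using e.finrank_eq)

/-- `ζ_A(s) = ∑_π 1 / (dim π)^s`, over the isomorphism classes of irreducible representations. -/
noncomputable def algZeta (A : Type*) [Ring A] [Algebra ℂ A] (s : ℂ) : ℂ :=
  ∑' π : AlgDual A, 1 / (π.dim : ℂ) ^ s

/-! ### The Drinfeld double of a finite group -/

/-- The underlying algebra of the Drinfeld (quantum) double `D(G)` of a finite group `G`.
The value at `(g, x)` is the coefficient of the basis element `δ_g ⊗ x`, where `δ_g` is the
delta function at `g` and `x` is a group element; the product is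
`(δ_g ⊗ x) (δ_h ⊗ y) = δ_{g, x h x⁻¹} (δ_g ⊗ x y)`. -/
def DrinfeldDouble (G : Type*) : Type _ := G → G → ℂ

namespace DrinfeldDouble

variable {G : Type*}

@[ext] theorem ext {a b : DrinfeldDouble G} (h : ∀ g x, a g x = b g x) : a = b :=
  funext fun g => funext fun x => h g x

noncomputable instance : AddCommGroup (DrinfeldDouble G) :=
  inferInstanceAs (AddCommGroup (G → G → ℂ))

noncomputable instance : Module ℂ (DrinfeldDouble G) :=
  inferInstanceAs (Module ℂ (G → G → ℂ))

@[simp] theorem add_apply (a b : DrinfeldDouble G) (g x : G) : (a + b) g x = a g x + b g x := rfl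

@[simp] theorem zero_apply (g x : G) : (0 : DrinfeldDouble G) g x = 0 := rfl

@[simp] theorem smul_apply (c : ℂ) (a : DrinfeldDouble G) (g x : G) :
    (c • a) g x = c * a g x := rfl

open Classical in
/-- The basis element `δ_g ⊗ x`. -/
noncomputable def single (g x : G) : DrinfeldDouble G :=
  fun h y => if h = g ∧ y = x then 1 else 0

variable [Group G]

open Classical in
/-- The unit is `∑_g δ_g ⊗ 1`. -/
noncomputable instance : One (DrinfeldDouble G) :=
  ⟨fun _ x => if x = 1 then 1 else 0⟩

open Classical in
theorem one_apply (g x : G) : (1 : DrinfeldDouble G) g x = if x = 1 then 1 else 0 := rfl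

variable [Fintype G]

noncomputable instance : Mul (DrinfeldDouble G) :=
  ⟨fun a b g x => ∑ y : G, a g y * b (y⁻¹ * g * y) (y⁻¹ * x)⟩

theorem mul_apply (a b : DrinfeldDouble G) (g x : G) :
    (a * b) g x = ∑ y : G, a g y * b (y⁻¹ * g * y) (y⁻¹ * x) := rfl

noncomputable instance : Ring (DrinfeldDouble G) :=
  { (inferInstance : AddCommGroup (DrinfeldDouble G)) with
    mul := (· * ·)
    one := 1
    left_distrib := fun a b c => by
      ext g x; simp [mul_apply, mul_add, Finset.sum_add_distrib]
    right_distrib := fun a b c => by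
      ext g x; simp [mul_apply, add_mul, Finset.sum_add_distrib]
    zero_mul := fun a => by ext g x; simp [mul_apply]
    mul_zero := fun a => by ext g x; simp [mul_apply]
    one_mul := fun a => by
      ext g x
      rw [mul_apply, Finset.sum_eq_single 1]
      · simp [one_apply]
      · intro y _ hy; simp [one_apply, hy]
      · simp
    mul_one := fun a => by
      ext g x
      rw [mul_apply, Finset.sum_eq_single x]
      · simp [one_apply]
      · intro y _ hy; simp [one_apply, inv_mul_eq_one, hy]
      · simp
    mul_assoc := fun a b c => by
      ext g x
      simp only [mul_apply, Finset.sum_mul, Finset.mul_sum]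
      rw [Finset.sum_comm]
      refine Finset.sum_congr rfl fun z _ => ?_
      rw [← Equiv.sum_comp (Equiv.mulLeft z)]
      refine Finset.sum_congr rfl fun y _ => ?_
      simp [mul_assoc] }

noncomputable instance : Algebra ℂ (DrinfeldDouble G) :=
  Algebra.ofModule
    (fun c a b => by ext g x; simp [mul_apply, Finset.mul_sum, mul_assoc])
    (fun c a b => by ext g x; simp [mul_apply, Finset.mul_sum, mul_left_comm])

open Classical in
theorem single_mul_single (g x h y : G) :
    single g x * single h y = if g = x * h * x⁻¹ then single g (x * y) else 0 := by
  ext k z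
  rw [mul_apply, Finset.sum_eq_single x]
  · have h1 : x⁻¹ * k * x = h ↔ k = x * h * x⁻¹ := by
      constructor <;> rintro rfl <;> group
    have h2 : x⁻¹ * z = y ↔ z = x * y := inv_mul_eq_iff_eq_mul
    simp only [single, h1, h2]
    by_cases h3 : g = x * h * x⁻¹
    · subst h3
      by_cases hk : k = x * h * x⁻¹ <;> simp [single, hk]
    · by_cases hk : k = g
      · subst hk; simp [h3]
      · simp [h3, hk]
  · intro w _ hw; simp [single, hw]
  · simp

end DrinfeldDouble

/-! Write Γ for the fundamental group. Burnside's lemma for conjugation on Hom(Γ, G) gives |Hom(Γ,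
G)/Ad G| = |G|⁻¹ ∑_k |Hom(Γ, C(k))|, since the homomorphisms fixed by k are those with values in
C(k) (`card_homModConj_mul_card`). Frobenius' formula |Hom(Γ, H)| = |H|^(2g-1) ζ_H(2g-2) for finite
H (`card_commutatorSolutions`) turns this into the first sum. Grouping the k by conjugacy class,
with |O| |C_ι(O)| = |G|, gives the second. Finally, D(G) is the algebra of the action groupoid of G
acting on itself by conjugation, hence the product over the classes O of the |O| × |O| matrices over
ℂ[C_ι(O)] (`doubleAlgEquiv`), so ζ_{D(G)}(s) = ∑_O |O|^(-s) ζ_{C_ι(O)}(s).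

For Frobenius' formula, the delta function at 1 is |H|⁻¹ ∑ d_i tr ρ_i, evaluated on the product of
commutators and summed over all 2g-tuples; by Schur's lemma the sum of ρ_i over all commutators is
the scalar (|H|/d_i)².

The topological input is that Hom(Γ, H) is the set of solutions of [a₁, b₁] ⋯ [a_g, b_g] = 1
(`IsClosedOrientableSurface.nonempty_hom_equiv`). No presentation of Γ is computed: homomorphisms
are replaced by holonomies, that is, functors from the fundamental groupoid to H. For g ≥ 1 the
surface is a quotient of the simply connected strip I × ℝ of polar coordinates, on which a holonomy
becomes a potential. The potential at the vertices of the polygon runs through the initial segments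
of the commutator word, and its periodicity is the relation. For uniqueness (`val_loop_eq`), paths
on the surface need not lift to the strip, but three open sets cover the surface, each carrying a
homotopy to a locally constant map whose tracks do lift. For existence
(`StandardSurface.exists_holonomy`), a solution defines a cocycle on the same three sets, hence a
covering space with fibre H, whose parallel transport yields the holonomy. The sphere needs only the
uniqueness argument. -/

open Topology Set
open scoped unitInterval

universe u v w

/-! ### Holonomies: multiplicative homotopy invariants of paths -/

/-- A `G`-valued holonomy on `X`: a homotopy invariant assignment of elements of `G` to paths
that turns concatenation into multiplication. -/
structure Holonomy (X : Type u) [TopologicalSpace X] (G : Type v) [Group G] where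
  /-- the value on a path -/
  val : ∀ {x y : X}, Path x y → G
  val_trans : ∀ {x y z : X} (p : Path x y) (q : Path y z), val (p.trans q) = val p * val q
  val_homotopic : ∀ {x y : X} {p q : Path x y}, p.Homotopic q → val p = val q

namespace Holonomy

variable {X : Type u} [TopologicalSpace X] {G : Type v} [Group G] (F F' : Holonomy X G)

theorem val_refl (x : X) : F.val (Path.refl x) = 1 := by
  have h := F.val_trans (Path.refl x) (Path.refl x)
  rw [Path.refl_trans_refl] at h
  exact left_eq_mul.mp h

theorem val_congr {x y x' y' : X} {p : Path x y} {q : Path x' y'} (h : ∀ t, p t = q t) :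
    F.val p = F.val q := by
  obtain rfl : x = x' := by simpa using h 0
  obtain rfl : y = y' := by simpa using h 1
  obtain rfl : p = q := by ext t; exact h t
  rfl

theorem val_eq_one_of_const {x y : X} {p : Path x y} (h : ∀ t, p t = x) : F.val p = 1 := by
  rw [← F.val_refl x]
  exact F.val_congr h

/-- Two holonomies that agree on all paths inside the members of an open cover are equal. -/
theorem val_eq_of_local {ι : Type w} {U : ι → Set X} (hU : ∀ i, IsOpen (U i))
    (hcov : ∀ x, ∃ i, x ∈ U i)
    (h : ∀ i {x y : X} (p : Path x y), (∀ t, p t ∈ U i) → F.val p = F'.val p)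
    {x y : X} (p : Path x y) : F.val p = F'.val p := by
  obtain ⟨t, ht0, hmono, ⟨n, hn⟩, hsub⟩ := exists_monotone_Icc_subset_open_cover_unitInterval
    (c := fun i => p ⁻¹' U i) (fun i => (hU i).preimage p.continuous)
    (fun s _ => by simpa using hcov (p s))
  -- The points `t m` are a Lebesgue subdivision: each piece of the path lies in one member of the
  -- cover.
  have key : ∀ m, F.val (p.subpath 0 (t m)) = F'.val (p.subpath 0 (t m)) := by
    intro m
    induction m with
    | zero => rw [ht0, Path.subpath_self, val_refl, val_refl]
    | succ m ih =>
      have hh : ((p.subpath 0 (t m)).trans (p.subpath (t m) (t (m + 1)))).Homotopic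
        (p.subpath 0 (t (m + 1))) := ⟨Path.Homotopy.subpathTransSubpath p _ _ _⟩
      rw [← F.val_homotopic hh, ← F'.val_homotopic hh, val_trans, val_trans, ih]
      congr 1
      obtain ⟨i, hi⟩ := hsub m
      refine h i _ fun s => ?_
      have hs : p.subpath (t m) (t (m + 1)) s ∈ range (p.subpath (t m) (t (m + 1))) := ⟨s, rfl⟩
      rw [Path.range_subpath_of_le _ _ _ (hmono m.le_succ)] at hs
      obtain ⟨r, hr, hrs⟩ := hs
      rw [← hrs]
      exact hi hr
  have h1 := key n
  rw [hn n le_rfl, Path.subpath_zero_one] at h1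
  have hcast : ∀ E : Holonomy X G, E.val (p.cast p.source p.target) = E.val p :=
    fun E => E.val_congr fun t => rfl
  rwa [hcast, hcast] at h1

/-- The gauge transform of a holonomy by a function on the points. -/
def twist (m : X → G) : Holonomy X G where
  val {x y} p := (m x)⁻¹ * F.val p * m y
  val_trans p q := by rw [F.val_trans]; group
  val_homotopic h := by rw [F.val_homotopic h]

/-- The pullback of a holonomy to the source of a continuous map, on paths. -/
def pull {R : Type w} [TopologicalSpace R] (f : C(R, X)) : Holonomy R G where
  val p := F.val (p.map f.continuous)
  val_trans p q := by rw [Path.map_trans, F.val_trans]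
  val_homotopic h := F.val_homotopic (h.map f)

/-- On a simply connected space the holonomy of a path depends only on its end points. -/
theorem val_eq_of_simplyConnected [SimplyConnectedSpace X] {x y : X} (p q : Path x y) :
    F.val p = F.val q :=
  F.val_homotopic (SimplyConnectedSpace.paths_homotopic p q)

/-- A contraction within `X`, defined on a saturated open set of the source of a quotient map
`Q : R → X`. -/
structure Contraction {R : Type w} [TopologicalSpace R] (Q : C(R, X)) (W : Set R) where
  isOpen : IsOpen W
  saturated : ∀ z z', Q z = Q z' → z ∈ W → z' ∈ W
  /-- the homotopy, lifted to `R` -/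
  K : R × I → R
  continuousOn : ContinuousOn K (W ×ˢ univ)
  zero : ∀ z ∈ W, K (z, 0) = z
  one : ∀ z ∈ W, ∀ᶠ z' in 𝓝 z, Q (K (z', 1)) = Q (K (z, 1))
  compat : ∀ z ∈ W, ∀ z' ∈ W, ∀ s, Q z = Q z' → Q (K (z, s)) = Q (K (z', s))

theorem isOpen_image_of_saturated {R : Type w} [TopologicalSpace R] {Q : R → X}
    (hQ : IsQuotientMap Q) {W : Set R} (hW : IsOpen W)
    (hs : ∀ z z', Q z = Q z' → z ∈ W → z' ∈ W) : IsOpen (Q '' W) := by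
  rw [← hQ.isOpen_preimage]
  convert hW
  ext z
  constructor
  · rintro ⟨z', hz', h⟩
    exact hs _ _ h hz'
  · exact fun h => ⟨z, h, rfl⟩

/-- The homotopy descends to the open set `Q '' W`. Its end map is locally constant, so it sends the
path `p` to a constant path, and `p` is homotopic to the track of its first end point followed by
the reversed track of its last. Both tracks are images of paths in `R`, where the holonomies agree.
-/
theorem val_eq_of_contraction {R : Type w} [TopologicalSpace R] {Q : C(R, X)}
    (hQ : IsQuotientMap Q)
    (h : ∀ {z z' : R} (p : Path z z'), F.val (p.map Q.continuous) = F'.val (p.map Q.continuous))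
    {W : Set R} (C : Contraction Q W) {x y : X} (p : Path x y) (hp : ∀ t, p t ∈ Q '' W) :
    F.val p = F'.val p := by
  have hU := isOpen_image_of_saturated hQ C.isOpen C.saturated
  set U := Q '' W with hUdef
  have hWU : ∀ z, Q z ∈ U → z ∈ W := by
    rintro z ⟨z', hz', h'⟩
    exact C.saturated _ _ h' hz'
  have hlift : ∀ u : U, ∃ z ∈ W, Q z = u := fun u => u.2
  choose l hlW hl using hlift
  let H : U × I → X := fun q => Q (C.K (l q.1, q.2))
  -- The section `l` need not be continuous. Continuity is checked after pulling back along the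
  -- restricted quotient map times `I`, where `compat` replaces the chosen lift by the given one.
  have hHc : Continuous H := by
    refine (hQ.restrictPreimage_isOpen hU).continuous_lift_prod_left ?_
    have h1 : (fun q : (Q ⁻¹' U) × I => H (U.restrictPreimage Q q.1, q.2)) =
        fun q : (Q ⁻¹' U) × I => Q (C.K (q.1.1, q.2)) := by
      funext q
      exact C.compat _ (hlW _) _ (hWU _ q.1.2) _ (hl _)
    rw [h1]
    refine Q.continuous.comp (C.continuousOn.comp_continuous (by fun_prop) fun q => ?_)
    exact ⟨hWU _ q.1.2, trivial⟩
  let x' : U := ⟨x, by simpa using hp 0⟩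
  let y' : U := ⟨y, by simpa using hp 1⟩
  let p' : Path x' y' :=
    { toFun := fun t => ⟨p t, hp t⟩
      continuous_toFun := by fun_prop
      source' := by simp [x']
      target' := by simp [y'] }
  let i : C(U, X) := ⟨Subtype.val, continuous_subtype_val⟩
  have hHi : ∀ z : Q ⁻¹' U, ∀ s, H (U.restrictPreimage Q z, s) = Q (C.K (z.1, s)) :=
    fun z s => C.compat _ (hlW _) _ (hWU _ z.2) _ (hl _)
  have hlc : IsLocallyConstant fun u : U => H (u, 1) := by
    intro S
    rw [← (hQ.restrictPreimage_isOpen hU).isOpen_preimage, isOpen_iff_eventually]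
    intro z hz
    have h1 := continuous_subtype_val.continuousAt.eventually (C.one z.1 (hWU _ z.2))
    filter_upwards [h1] with z' hz'
    simp only [mem_preimage, hHi] at hz ⊢
    rwa [hz']
  let HH : i.Homotopy ⟨fun u => H (u, 1), by fun_prop⟩ :=
    { toFun := fun q => H (q.2, q.1)
      continuous_toFun := by fun_prop
      map_zero_left := fun u => by
        change Q (C.K (l u, 0)) = u
        rw [C.zero _ (hlW u), hl]
      map_one_left := fun u => rfl }
  have key : ∀ E : Holonomy X G, E.val p = E.val (HH.evalAt x') * (E.val (HH.evalAt y'))⁻¹ := by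
    intro E
    -- The naturality square of the homotopy `HH` along `p'`; the side coming from the end map is a
    -- constant path.
    have h1 := E.val_homotopic (Path.Homotopic.map_trans_evalAt HH p')
    rw [E.val_trans, E.val_trans] at h1
    have h2 : E.val (p'.map (map_continuous (⟨fun u => H (u, 1), by fun_prop⟩ : C(U, X)))) = 1 := by
      refine E.val_eq_one_of_const fun t => ?_
      exact (hlc.comp_continuous p'.continuous).apply_eq_of_preconnectedSpace t 0 |>.trans
        (congrArg (fun u => H (u, 1)) p'.source)
    have h3 : E.val (p'.map (map_continuous i)) = E.val p := E.val_congr fun t => rfl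
    rw [h2, h3, mul_one] at h1
    rw [← h1, mul_inv_cancel_right]
  have track : ∀ u : U, F.val (HH.evalAt u) = F'.val (HH.evalAt u) := by
    intro u
    let q : Path (C.K (l u, 0)) (C.K (l u, 1)) :=
      { toFun := fun t => C.K (l u, t)
        continuous_toFun := C.continuousOn.comp_continuous (by fun_prop)
          fun t => ⟨hlW u, trivial⟩
        source' := rfl
        target' := rfl }
    have h1 : ∀ E : Holonomy X G, E.val (HH.evalAt u) = E.val (q.map Q.continuous) :=
      fun E => E.val_congr fun t => rfl
    rw [h1, h1, h]
  rw [key F, key F', track, track]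

/-- Two holonomies on a quotient `X` of `R` that agree on the images of paths in `R` are equal,
if `X` is covered by contractions. -/
theorem val_eq_of_contractions {R : Type w} [TopologicalSpace R] {Q : C(R, X)}
    (hQ : IsQuotientMap Q)
    (h : ∀ {z z' : R} (p : Path z z'), F.val (p.map Q.continuous) = F'.val (p.map Q.continuous))
    {ι : Type*} {W : ι → Set R} (C : ∀ i, Contraction Q (W i)) (hW : ∀ z, ∃ i, z ∈ W i)
    {x y : X} (p : Path x y) : F.val p = F'.val p := by
  refine F.val_eq_of_local F' (U := fun i => Q '' W i)
    (fun i => isOpen_image_of_saturated hQ (C i).isOpen (C i).saturated) (fun x => ?_)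
    (fun i x y p hp => F.val_eq_of_contraction F' hQ h (C i) p hp) p
  obtain ⟨z, rfl⟩ := hQ.surjective x
  obtain ⟨i, hi⟩ := hW z
  exact ⟨i, z, hi, rfl⟩

/-! #### Holonomies and homomorphisms from the fundamental group -/

/-- The homomorphism from the fundamental group given by a holonomy. The inverse is there because
the multiplication in the fundamental group is composition of arrows in the opposite order. -/
def toHom (x : X) : FundamentalGroup X x →* G where
  toFun a := (Quotient.lift (fun p : Path x x => F.val p) (fun _ _ h => F.val_homotopic h)
    (a : Path.Homotopic.Quotient x x))⁻¹
  map_one' := by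
    change (F.val (Path.refl x))⁻¹ = 1
    rw [F.val_refl, inv_one]
  map_mul' a b := by
    obtain ⟨p, rfl⟩ := Path.Homotopic.Quotient.mk_surjective a
    obtain ⟨q, rfl⟩ := Path.Homotopic.Quotient.mk_surjective b
    change (F.val (q.trans p))⁻¹ = (F.val p)⁻¹ * (F.val q)⁻¹
    rw [F.val_trans, mul_inv_rev]

theorem toHom_mk (x : X) (p : Path x x) :
    F.toHom x (FundamentalGroup.fromPath (Path.Homotopic.Quotient.mk p)) = (F.val p)⁻¹ := rfl

open Classical in
/-- A path from the base point to every other point, constant for the base point. -/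
noncomputable def basePath [PathConnectedSpace X] (x y : X) : Path x y :=
  if h : x = y then (Path.refl x).cast rfl h.symm else PathConnectedSpace.somePath x y

theorem basePath_self [PathConnectedSpace X] (x : X) : basePath x x = Path.refl x := by
  simp [basePath]

/-- The holonomy of a homomorphism from the fundamental group. -/
noncomputable def ofHom [PathConnectedSpace X] {x : X} (φ : FundamentalGroup X x →* G) :
    Holonomy X G where
  val {y z} p := (φ (FundamentalGroup.fromPath (Path.Homotopic.Quotient.mk
    ((basePath x y).trans (p.trans (basePath x z).symm)))))⁻¹
  val_trans {y z w} p q := by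
    rw [← mul_inv_rev, ← map_mul]
    congr 2
    simp only [FundamentalGroup.mul_def, Path.Homotopic.Quotient.mk_trans,
      Path.Homotopic.Quotient.mk_symm, Path.Homotopic.Quotient.trans_assoc]
    rw [← Path.Homotopic.Quotient.trans_assoc (Path.Homotopic.Quotient.mk (basePath x z)).symm
      (Path.Homotopic.Quotient.mk (basePath x z)), Path.Homotopic.Quotient.symm_trans,
      Path.Homotopic.Quotient.refl_trans]
  val_homotopic h := by
    simp only [Path.Homotopic.Quotient.mk_trans, Path.Homotopic.Quotient.eq.mpr h]

/-- For loops at the base point nothing is conjugated, because `basePath x x` was chosen constant.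
-/
theorem ofHom_val [PathConnectedSpace X] {x : X} (φ : FundamentalGroup X x →* G) (p : Path x x) :
    (ofHom φ).val p = (φ (FundamentalGroup.fromPath (Path.Homotopic.Quotient.mk p)))⁻¹ := by
  change (φ (FundamentalGroup.fromPath (Path.Homotopic.Quotient.mk
    ((basePath x x).trans (p.trans (basePath x x).symm)))))⁻¹ = _
  simp only [basePath_self, Path.Homotopic.Quotient.mk_trans, Path.Homotopic.Quotient.mk_symm,
    Path.Homotopic.Quotient.mk_refl, Path.Homotopic.Quotient.refl_trans]
  rw [← Path.Homotopic.Quotient.mk_refl, ← Path.Homotopic.Quotient.mk_symm, Path.refl_symm,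
    Path.Homotopic.Quotient.mk_refl, Path.Homotopic.Quotient.trans_refl]

theorem toHom_ofHom [PathConnectedSpace X] {x : X} (φ : FundamentalGroup X x →* G) :
    (ofHom φ).toHom x = φ := by
  ext a
  obtain ⟨p, rfl⟩ := Path.Homotopic.Quotient.mk_surjective a
  change ((ofHom φ).val p)⁻¹ = _
  rw [ofHom_val, inv_inv]

/-! #### Holonomies from cocycles -/

/-- Locally constant functions on the members of a saturated open cover of the source `R` of a
quotient map, whose quotients are well defined on the target. -/
structure Cocycle {R : Type w} [TopologicalSpace R] (Q : R → X) (G : Type v) [Group G]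
    (ι : Type*) where
  /-- the members of the cover -/
  W : ι → Set R
  isOpen : ∀ i, IsOpen (W i)
  saturated : ∀ i z z', Q z = Q z' → z ∈ W i → z' ∈ W i
  cover : ∀ z, ∃ i, z ∈ W i
  /-- the locally constant functions -/
  c : ι → R → G
  locConst : ∀ i, ∀ z ∈ W i, ∀ᶠ z' in 𝓝 z, c i z' = c i z
  compat : ∀ i j z z', Q z = Q z' → z ∈ W i → z ∈ W j →
    (c i z)⁻¹ * c j z = (c i z')⁻¹ * c j z'

end Holonomy

namespace Holonomy.Cocycle

variable {X : Type u} [TopologicalSpace X] {G : Type v} [Group G] {R : Type w} [TopologicalSpace R]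
  {Q : R → X} {ι : Type*} (D : Cocycle Q G ι) (hQ : IsQuotientMap Q)

include hQ in
theorem exists_index (x : X) : ∃ i, ∀ z, Q z = x → z ∈ D.W i := by
  obtain ⟨z, rfl⟩ := hQ.surjective x
  obtain ⟨i, hi⟩ := D.cover z
  exact ⟨i, fun z' h => D.saturated i _ _ h.symm hi⟩

/-- A chart around every point. -/
noncomputable def index (x : X) : ι := (D.exists_index hQ x).choose

theorem mem_index (z : R) : z ∈ D.W (D.index hQ (Q z)) :=
  (D.exists_index hQ (Q z)).choose_spec z rfl

/-- The transition function from the chart `i` to the chart `j`. -/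
noncomputable def trans (i j : ι) (x : X) : G :=
  (D.c j (Function.surjInv hQ.surjective x))⁻¹ * D.c i (Function.surjInv hQ.surjective x)

/-- By `compat`, the preimage picked by `Function.surjInv` may be replaced by any other. -/
theorem trans_eq {i j : ι} {z : R} (hi : z ∈ D.W i) (hj : z ∈ D.W j) :
    D.trans hQ i j (Q z) = (D.c j z)⁻¹ * D.c i z := by
  have h := Function.surjInv_eq hQ.surjective (Q z)
  exact D.compat j i _ _ h (D.saturated j _ _ h.symm hj) (D.saturated i _ _ h.symm hi)

/-- The covering space of a cocycle, as a fibre bundle with discrete fibre. -/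
noncomputable def core [TopologicalSpace G] [DiscreteTopology G] : FiberBundleCore ι X G where
  baseSet i := Q '' D.W i
  isOpen_baseSet i := isOpen_image_of_saturated hQ (D.isOpen i) (D.saturated i)
  indexAt := D.index hQ
  mem_baseSet_at x := by
    obtain ⟨z, rfl⟩ := hQ.surjective x
    exact ⟨z, D.mem_index hQ z, rfl⟩
  coordChange i j x v := D.trans hQ i j x * v
  coordChange_self i x hx v := by
    obtain ⟨z, hz, rfl⟩ := hx
    rw [D.trans_eq hQ hz hz, inv_mul_cancel, one_mul]
  continuousOn_coordChange i j := by
    have hU := (isOpen_image_of_saturated hQ (D.isOpen i) (D.saturated i)).inter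
      (isOpen_image_of_saturated hQ (D.isOpen j) (D.saturated j))
    have h : ContinuousOn (D.trans hQ i j) (Q '' D.W i ∩ Q '' D.W j) := by
      rw [hQ.continuousOn_isOpen_iff hU]
      rintro z ⟨⟨z₁, hz₁, h₁⟩, ⟨z₂, hz₂, h₂⟩⟩
      have hi := D.saturated i _ _ h₁ hz₁
      have hj := D.saturated j _ _ h₂ hz₂
      refine ContinuousAt.continuousWithinAt ?_
      refine (continuousAt_const (y := D.trans hQ i j (Q z))).congr ?_
      filter_upwards [D.locConst i z hi, D.locConst j z hj, (D.isOpen i).mem_nhds hi,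
        (D.isOpen j).mem_nhds hj] with z' h1 h2 h3 h4
      simp only [Function.comp]
      rw [D.trans_eq hQ hi hj, D.trans_eq hQ h3 h4, h1, h2]
    exact (h.comp continuousOn_fst fun p hp => hp.1).mul continuousOn_snd
  coordChange_comp i j k x hx v := by
    obtain ⟨⟨⟨z, hz, rfl⟩, ⟨z₂, hz₂, h₂⟩⟩, ⟨z₃, hz₃, h₃⟩⟩ := hx
    have hj := D.saturated j _ _ h₂ hz₂
    have hk := D.saturated k _ _ h₃ hz₃
    rw [D.trans_eq hQ hj hk, D.trans_eq hQ hz hj, D.trans_eq hQ hz hk]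
    group

section

variable [TopologicalSpace G] [DiscreteTopology G]

theorem isCoveringMap_core : IsCoveringMap (D.core hQ).proj :=
  FiberBundle.isCoveringMap (F := G) (E := (D.core hQ).Fiber)

/-- The point of the covering space over `x` with the coordinate `k`. -/
noncomputable def pt (x : X) (k : G) : (D.core hQ).TotalSpace := ⟨x, k⟩

/-- The coordinate of a point of the covering space. -/
noncomputable def coord (e : (D.core hQ).TotalSpace) : G := e.2

theorem coord_pt (x : X) (k : G) : D.coord hQ (D.pt hQ x k) = k := rfl

/-- Coordinate changes multiply on the left, so right multiplication commutes with them: the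
covering is principal. -/
theorem continuous_mul_right (k : G) : Continuous
    (fun e : (D.core hQ).TotalSpace => D.pt hQ ((D.core hQ).proj e) (D.coord hQ e * k)) := by
  rw [continuous_iff_continuousAt]
  intro e
  rw [FiberBundle.continuousAt_totalSpace]
  refine ⟨(D.isCoveringMap_core hQ).continuous.continuousAt, ?_⟩
  have h := ((FiberBundle.continuousAt_totalSpace G (fun e : (D.core hQ).TotalSpace => e)
    (x₀ := e)).mp continuousAt_id).2
  refine (h.mul (continuousAt_const (y := k))).congr (Filter.Eventually.of_forall fun e' => ?_)
  exact mul_assoc _ _ _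

/-- The transition `(c j)⁻¹ * c i` takes the coordinate `(c i)⁻¹` to `(c j)⁻¹`, so these coordinates
describe one global map from `R` to the covering space. Composed with a path in `R`, it lifts the
image of that path. -/
theorem continuous_section (hc : Continuous Q) : Continuous
    (fun z : R => D.pt hQ (Q z) (D.c (D.index hQ (Q z)) z)⁻¹) := by
  rw [continuous_iff_continuousAt]
  intro z
  rw [FiberBundle.continuousAt_totalSpace]
  refine ⟨hc.continuousAt, ?_⟩
  have hi := D.mem_index hQ z
  refine (continuousAt_const (y := (D.c (D.index hQ (Q z)) z)⁻¹)).congr ?_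
  filter_upwards [D.locConst _ z hi, (D.isOpen _).mem_nhds hi] with z' h1 h2
  change _ = D.trans hQ (D.index hQ (Q z')) (D.index hQ (Q z)) (Q z') *
    (D.c (D.index hQ (Q z')) z')⁻¹
  rw [D.trans_eq hQ (D.mem_index hQ z') h2, h1]
  group

/-- The parallel transport of the unit along a path. -/
noncomputable def transport {x y : X} (p : Path x y) : G :=
  D.coord hQ ((D.isCoveringMap_core hQ).liftPath p (D.pt hQ x 1) p.source 1)

/-- By uniqueness of lifts, every lift is a right translate of the one that starts at the unit. -/
theorem coord_lift_one {x y : X} (p : Path x y) (L : C(I, (D.core hQ).TotalSpace))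
    (hL : (D.core hQ).proj ∘ L = p) :
    D.coord hQ (L 1) = D.transport hQ p * D.coord hQ (L 0) := by
  set k := D.coord hQ (L 0) with hk
  let L' : C(I, (D.core hQ).TotalSpace) := (⟨_, D.continuous_mul_right hQ k⁻¹⟩ :
    C((D.core hQ).TotalSpace, (D.core hQ).TotalSpace)).comp L
  have h0 : L' 0 = D.pt hQ x 1 := by
    change D.pt hQ ((D.core hQ).proj (L 0)) (k * k⁻¹) = _
    rw [mul_inv_cancel, show (D.core hQ).proj (L 0) = x by simpa using congr_fun hL 0]
  have h := ((D.isCoveringMap_core hQ).eq_liftPath_iff' (γ := p) (e := D.pt hQ x 1)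
    (γ_0 := p.source) (Γ := L')).mpr ⟨hL, h0⟩
  have h1 : D.coord hQ (L' 1) = D.transport hQ p := by rw [h]; rfl
  rw [← h1]
  change _ = D.coord hQ (L 1) * k⁻¹ * k
  rw [inv_mul_cancel_right]

theorem transport_trans {x y z : X} (p : Path x y) (q : Path y z) :
    D.transport hQ (p.trans q) = D.transport hQ q * D.transport hQ p := by
  have cov := D.isCoveringMap_core hQ
  have h0 : q 0 = (D.core hQ).proj (cov.liftPath p (D.pt hQ x 1) p.source 1) := by
    have := congr_fun (cov.liftPath_lifts p (D.pt hQ x 1) p.source) 1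
    simpa using this.symm
  have h := congrArg (fun L : C(I, (D.core hQ).TotalSpace) => D.coord hQ (L 1))
    (cov.liftPath_trans (e := D.pt hQ x 1) rfl p q)
  have h2 := D.coord_lift_one hQ q (cov.liftPath q _ h0) (cov.liftPath_lifts q _ h0)
  rw [cov.liftPath_zero] at h2
  refine Eq.trans ?_ (h.trans (Eq.trans ?_ h2))
  · rfl
  · exact congrArg (D.coord hQ) (Path.target _)

end

/-- The holonomy of a cocycle. -/
theorem exists_holonomy (hc : Continuous Q) : ∃ F : Holonomy X G, ∀ {z z' : R} (p : Path z z'),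
    F.val (p.map hc) = (D.c (D.index hQ (Q z)) z)⁻¹ * D.c (D.index hQ (Q z')) z' := by
  let _ : TopologicalSpace G := ⊥
  have : DiscreteTopology G := ⟨rfl⟩
  -- Transport reverses the order of concatenation, hence the inverse.
  refine ⟨⟨fun p => (D.transport hQ p)⁻¹, fun {x y z} p q => ?_, fun {x y p q} h => ?_⟩,
    fun {z z'} p => ?_⟩
  · rw [transport_trans, mul_inv_rev]
  · have := (D.isCoveringMap_core hQ).liftPath_apply_one_eq_of_homotopicRel h
      (D.pt hQ x 1) p.source q.source
    exact congrArg (fun e => (D.coord hQ e)⁻¹) this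
  · have h1 := D.coord_lift_one hQ (p.map hc)
      ((⟨_, D.continuous_section hQ hc⟩ : C(R, (D.core hQ).TotalSpace)).comp p.toContinuousMap)
      rfl
    simp only [ContinuousMap.comp_apply, ContinuousMap.coe_mk, coord_pt,
      show p.toContinuousMap 0 = z from p.source, show p.toContinuousMap 1 = z' from p.target] at h1
    change (D.transport hQ (p.map hc))⁻¹ = _
    rw [eq_mul_inv_of_mul_eq h1.symm]
    group

end Holonomy.Cocycle

/-! ### Polar coordinates on the standard surface -/

namespace StandardSurface

/-- Polar coordinates on the disc, with the angle measured in sides of the `4 g`-gon. -/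
noncomputable def polar (g : ℕ) (z : I × ℝ) : ClosedDisc :=
  ⟨(z.1 : ℝ) * (polygonBoundary g z.2 : ℂ), by
    have h1 : ‖(polygonBoundary g z.2 : ℂ)‖ ≤ 1 := 
      mem_closedBall_zero_iff.mp (polygonBoundary g z.2).2
    rw [mem_closedBall_zero_iff, norm_mul, Complex.norm_real, Real.norm_of_nonneg z.1.2.1]
    exact mul_le_one₀ z.1.2.2 (norm_nonneg _) h1⟩

theorem coe_polar (g : ℕ) (r : I) (t : ℝ) : (polar g (r, t) : ℂ) =
    (r : ℝ) * Complex.exp ((2 * Real.pi * t / (4 * g) : ℝ) * Complex.I) := rfl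

theorem polar_one (g : ℕ) (t : ℝ) : polar g (1, t) = polygonBoundary g t := by
  ext
  simp [polar]

theorem continuous_polar (g : ℕ) : Continuous (polar g) := by
  unfold polar polygonBoundary
  fun_prop

theorem norm_polar (g : ℕ) (r : I) (t : ℝ) : ‖(polar g (r, t) : ℂ)‖ = r := by
  rw [coe_polar, norm_mul, Complex.norm_exp_ofReal_mul_I, mul_one, Complex.norm_real,
    Real.norm_of_nonneg r.2.1]

theorem polar_zero (g : ℕ) (t t' : ℝ) : polar g (0, t) = polar g (0, t') := by
  ext
  simp [coe_polar]

variable {g : ℕ}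

theorem polar_add_period (hg : 0 < g) (r : I) (t : ℝ) :
    polar g (r, t + 4 * g) = polar g (r, t) := by
  have hg' : (g : ℝ) ≠ 0 := by positivity
  ext
  rw [coe_polar, coe_polar, ← Complex.exp_periodic ((2 * Real.pi * t / (4 * g) : ℝ) * Complex.I)]
  congr 2
  push_cast
  have : (g : ℂ) ≠ 0 := by exact_mod_cast hg'
  field_simp

theorem polar_surjOn (hg : 0 < g) (w : ClosedDisc) :
    ∃ r : I, ∃ t ∈ Icc (0 : ℝ) (4 * g), polar g (r, t) = w := by
  have hg' : (0 : ℝ) < g := by positivity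
  obtain ⟨w, hw⟩ := w
  rw [mem_closedBall_zero_iff] at hw
  have hpi := Real.pi_pos
  set s := toIcoMod Real.two_pi_pos 0 w.arg with hs
  have hs0 := toIcoMod_mem_Ico Real.two_pi_pos 0 w.arg
  rw [← hs, zero_add] at hs0
  refine ⟨⟨‖w‖, norm_nonneg w, hw⟩, s * (4 * g) / (2 * Real.pi), ⟨?_, ?_⟩, ?_⟩
  · have := hs0.1
    positivity
  · rw [div_le_iff₀ (by positivity)]
    nlinarith [hs0.2]
  · ext
    rw [coe_polar]
    have h1 : 2 * Real.pi * (s * (4 * g) / (2 * Real.pi)) / (4 * g) = s := by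
      field_simp
    rw [h1]
    have h2 : s = w.arg - toIcoDiv Real.two_pi_pos 0 w.arg • (2 * Real.pi) := rfl
    rw [h2]
    have h3 : ((w.arg - toIcoDiv Real.two_pi_pos 0 w.arg • (2 * Real.pi) : ℝ) : ℂ) * Complex.I =
        w.arg * Complex.I - (toIcoDiv Real.two_pi_pos 0 w.arg : ℤ) * (2 * Real.pi * Complex.I) := by
      rw [zsmul_eq_mul]; push_cast; ring
    rw [h3, Complex.exp_sub, Complex.exp_int_mul_two_pi_mul_I, div_one]
    exact Complex.norm_mul_exp_arg_mul_I w

/-- One full turn, `I × [0, 4g]`, is compact and already covers the Hausdorff disc, so the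
restriction to it is a closed surjection. -/
theorem isQuotientMap_polar (hg : 0 < g) : IsQuotientMap (polar g) := by
  let f : I × Icc (0 : ℝ) (4 * g) → ClosedDisc := fun z => polar g (z.1, z.2)
  have hf : Continuous f := (continuous_polar g).comp (by fun_prop)
  have hs : Function.Surjective f := fun w => by
    obtain ⟨r, t, ht, h⟩ := polar_surjOn hg w
    exact ⟨(r, ⟨t, ht⟩), h⟩
  have h2 : IsQuotientMap f := hf.isClosedMap.isQuotientMap hf hs
  exact IsQuotientMap.of_comp (f := fun z : I × Icc (0 : ℝ) (4 * g) => ((z.1, (z.2 : ℝ)) : I × ℝ))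
    (by fun_prop) (continuous_polar g) h2

theorem eq_of_polar_eq (hg : 0 < g) {r r' : I} {t t' : ℝ}
    (h : polar g (r, t) = polar g (r', t')) :
    r = r' ∧ (r = 0 ∨ ∃ k : ℤ, t = t' + k * (4 * g)) := by
  have hg' : (g : ℝ) ≠ 0 := by positivity
  have hr : r = r' := by
    ext
    rw [← norm_polar g r t, h, norm_polar]
  subst hr
  refine ⟨rfl, or_iff_not_imp_left.mpr fun h0 => ?_⟩
  have h0' : ((r : ℝ) : ℂ) ≠ 0 := by
    rw [Complex.ofReal_ne_zero]
    exact fun h1 => h0 (Subtype.ext h1)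
  have h1 := congrArg (Subtype.val : ClosedDisc → ℂ) h
  rw [coe_polar, coe_polar, mul_right_inj' h0', Complex.exp_eq_exp_iff_exists_int] at h1
  obtain ⟨k, hk⟩ := h1
  refine ⟨k, ?_⟩
  have h2 : ((2 * Real.pi * t / (4 * g) : ℝ) : ℂ) * Complex.I =
      ((2 * Real.pi * t' / (4 * g) + k * (2 * Real.pi) : ℝ) : ℂ) * Complex.I := by
    rw [hk]; push_cast; ring
  have h3 := mul_right_cancel₀ Complex.I_ne_zero h2
  rw [Complex.ofReal_inj] at h3
  have hpi := Real.pi_pos.ne'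
  field_simp at h3
  have h4 : 2 * (t - (t' + k * (4 * g))) = 0 := by linarith
  linarith

/-- The pairs of sides that are glued: the side from `j` to `j + 1` is glued to the side from
`N - j` to `N - j - 1`. -/
def IsGlued (g : ℕ) (j N : ℤ) : Prop :=
  ∃ i : ℕ, i < g ∧ ((j = 4 * i ∧ N = 8 * i + 3) ∨ (j = 4 * i + 1 ∧ N = 8 * i + 5))

/-- The quotient map from the polar coordinates to the standard surface. -/
noncomputable def proj (g : ℕ) : C(I × ℝ, StandardSurface g) :=
  ⟨fun z => Quot.mk _ (polar g z), continuous_quot_mk.comp (continuous_polar g)⟩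

theorem isQuotientMap_proj (hg : 0 < g) : IsQuotientMap (proj g) :=
  isQuotientMap_quot_mk.comp (isQuotientMap_polar hg)

theorem proj_zero (t t' : ℝ) : proj g (0, t) = proj g (0, t') :=
  congrArg (Quot.mk _) (polar_zero g t t')

theorem proj_add_period (hg : 0 < g) (r : I) (t : ℝ) :
    proj g (r, t + 4 * g) = proj g (r, t) :=
  congrArg (Quot.mk _) (polar_add_period hg r t)

theorem proj_glued {j N : ℤ} (h : IsGlued g j N) {t : ℝ} (ht : t ∈ Icc (j : ℝ) (j + 1)) :
    proj g (1, t) = proj g (1, N - t) := by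
  change Quot.mk _ (polar g (1, t)) = Quot.mk _ (polar g (1, N - t))
  rw [polar_one, polar_one]
  apply Quot.sound
  obtain ⟨i, hi, ⟨rfl, rfl⟩ | ⟨rfl, rfl⟩⟩ := h
  · have h1 := SurfaceRel.a (⟨i, hi⟩ : Fin g) (t - 4 * i) (by
      push_cast at ht; constructor <;> linarith [ht.1, ht.2])
    convert h1 using 2 <;> push_cast <;> ring
  · have h1 := SurfaceRel.b (⟨i, hi⟩ : Fin g) (t - 4 * i - 1) (by
      push_cast at ht; constructor <;> linarith [ht.1, ht.2])
    convert h1 using 2 <;> push_cast <;> ring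

/-- A function of the polar coordinates descends to the surface if it is compatible with the
gluing. -/
theorem eq_of_proj_eq (hg : 0 < g) {Y : Type*} (h : I × ℝ → Y)
    (h0 : ∀ t t', h (0, t) = h (0, t'))
    (hp : ∀ r t, h (r, t + 4 * g) = h (r, t))
    (hside : ∀ j N, IsGlued g j N → ∀ t ∈ Icc (j : ℝ) (j + 1), h (1, t) = h (1, N - t))
    {z z' : I × ℝ} (hz : proj g z = proj g z') : h z = h z' := by
  have hpn : ∀ r t, ∀ k : ℤ, h (r, t + k * (4 * g)) = h (r, t) := by
    intro r t k
    have : Function.Periodic (fun t => h (r, t)) (4 * g : ℝ) := fun t => hp r t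
    exact this.int_mul k t
  have hpol : ∀ z z', polar g z = polar g z' → h z = h z' := by
    rintro ⟨r, t⟩ ⟨r', t'⟩ hzz
    obtain ⟨rfl, rfl | ⟨k, rfl⟩⟩ := eq_of_polar_eq hg hzz
    · exact h0 _ _
    · exact hpn _ _ _
  have hsurj := (isQuotientMap_polar hg).surjective
  let h' : ClosedDisc → Y := fun w => h (Function.surjInv hsurj w)
  have hh' : ∀ z, h' (polar g z) = h z := fun z => hpol _ _ (Function.surjInv_eq hsurj _)
  have hb : ∀ t, h' (polygonBoundary g t) = h (1, t) := fun t => by rw [← polar_one, hh']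
  let q : StandardSurface g → Y := Quot.lift h' (by
    rintro _ _ (⟨i, t, ht⟩ | ⟨i, t, ht⟩ | ⟨rfl, -, -, -, -⟩)
    · rw [hb, hb]
      have h1 := hside _ _ ⟨i, i.2, Or.inl ⟨rfl, rfl⟩⟩ (4 * (i : ℕ) + t) (by
        push_cast; constructor <;> linarith [ht.1, ht.2])
      rw [h1]; congr 2; push_cast; ring
    · rw [hb, hb]
      have h1 := hside _ _ ⟨i, i.2, Or.inr ⟨rfl, rfl⟩⟩ (4 * (i : ℕ) + 1 + t) (by
        push_cast; constructor <;> linarith [ht.1, ht.2])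
      rw [h1]; congr 2; push_cast; ring
    · exact absurd hg (lt_irrefl 0))
  have hq : ∀ z, q (proj g z) = h z := hh'
  rw [← hq, hz, hq]

/-! #### An open cover of the surface -/

/-- The region of the polar coordinates around the centre of the polygon. -/
def innerRegion : Set (I × ℝ) := {z | z.1 < 1}

/-- The region of the polar coordinates without the rays at the angles `c + 1 / 2 + m`. -/
def sectors (c : ℝ) : Set (I × ℝ) := {z | 0 < z.1 ∧ ∃ m : ℤ, |z.2 - c - m| < 1 / 2}

theorem isOpen_innerRegion : IsOpen innerRegion :=
  isOpen_lt continuous_fst continuous_const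

theorem isOpen_sectors (c : ℝ) : IsOpen (sectors c) := by
  have : sectors c = {z | 0 < z.1} ∩ ⋃ m : ℤ, {z : I × ℝ | |z.2 - c - m| < 1 / 2} := by
    ext z; simp [sectors]
  rw [this]
  refine (isOpen_lt continuous_const continuous_fst).inter (isOpen_iUnion fun m => ?_)
  exact isOpen_lt (by fun_prop) continuous_const

/-- On the boundary, offset `0` misses only the half-integral angles, and these are centres of
sectors of offset `1 / 2`. -/
theorem cover_regions (z : I × ℝ) :
    z ∈ innerRegion ∨ z ∈ sectors 0 ∨ z ∈ sectors (1 / 2) := by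
  rcases lt_or_ge z.1 1 with h | h
  · exact Or.inl h
  right
  have h0 : 0 < z.1 := lt_of_lt_of_le zero_lt_one h
  have h1 := abs_sub_round z.2
  rcases h1.lt_or_eq with h2 | h2
  · left
    exact ⟨h0, round z.2, by simpa using h2⟩
  · right
    rcases abs_eq (by norm_num : (0 : ℝ) ≤ 1 / 2) |>.mp h2 with h3 | h3
    · exact ⟨h0, round z.2, by rw [abs_lt]; constructor <;> linarith⟩
    · exact ⟨h0, round z.2 - 1, by push_cast; rw [abs_lt]; constructor <;> linarith⟩

theorem innerRegion_saturated (hg : 0 < g) {z z' : I × ℝ} (h : proj g z = proj g z')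
    (hz : z ∈ innerRegion) : z' ∈ innerRegion := by
  -- Saturation is the descent criterion for a function with values in `Prop`.
  have := eq_of_proj_eq hg (fun z => z.1 < 1) (fun _ _ => rfl) (fun _ _ => rfl)
    (fun _ _ _ _ _ => rfl) h
  exact this.mp hz

theorem round_eq_of_abs_lt {x : ℝ} {m : ℤ} (h : |x - m| < 1 / 2) : round x = m := by
  rw [abs_lt] at h
  rw [round_eq_iff]
  constructor <;> linarith [h.1, h.2]

theorem mem_sectors_iff (c : ℝ) (z : I × ℝ) :
    z ∈ sectors c ↔ 0 < z.1 ∧ |z.2 - c - round (z.2 - c)| < 1 / 2 := by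
  constructor
  · rintro ⟨h0, m, hm⟩
    rw [round_eq_of_abs_lt hm]
    exact ⟨h0, hm⟩
  · rintro ⟨h0, h⟩
    exact ⟨h0, _, h⟩

theorem mem_sectors_period (c : ℝ) (r : I) (t : ℝ) (k : ℤ) :
    (r, t + k) ∈ sectors c ↔ (r, t) ∈ sectors c := by
  simp only [sectors, mem_ofPred_eq]
  refine and_congr_right fun _ => ⟨?_, ?_⟩
  · rintro ⟨m, hm⟩
    refine ⟨m - k, ?_⟩
    push_cast
    convert hm using 2
    ring
  · rintro ⟨m, hm⟩
    refine ⟨m + k, ?_⟩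
    push_cast
    convert hm using 2
    ring

/-- The gluings are the reflections `t ↦ N - t`. They preserve the excluded angles `c + 1 / 2 + ℤ`
because `2 * c` is an integer. -/
theorem mem_sectors_neg {c : ℝ} {n : ℤ} (hc : 2 * c = n) (r : I) (t : ℝ) (N : ℤ) :
    (r, N - t) ∈ sectors c ↔ (r, t) ∈ sectors c := by
  simp only [sectors, mem_ofPred_eq]
  refine and_congr_right fun _ => ⟨?_, ?_⟩
  · rintro ⟨m, hm⟩
    refine ⟨N - m - n, ?_⟩
    push_cast
    rw [abs_sub_comm] at hm
    convert hm using 2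
    linarith
  · rintro ⟨m, hm⟩
    refine ⟨N - m - n, ?_⟩
    push_cast
    rw [abs_sub_comm] at hm
    convert hm using 2
    linarith

theorem sectors_saturated (hg : 0 < g) {c : ℝ} {n : ℤ} (hc : 2 * c = n) {z z' : I × ℝ}
    (h : proj g z = proj g z') (hz : z ∈ sectors c) : z' ∈ sectors c := by
  have := eq_of_proj_eq hg (fun z => z ∈ sectors c) (fun _ _ => by simp [sectors])
    (fun r t => by
      have := mem_sectors_period c r t (4 * g)
      push_cast at this
      exact propext this)
    (fun j N _ t _ => (propext (mem_sectors_neg hc 1 t N)).symm) h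
  exact this.mp hz

/-- The centre of the sector that contains an angle. -/
noncomputable def centre (c t : ℝ) : ℝ := c + round (t - c)

theorem eventually_round_eq {c : ℝ} {z : I × ℝ} (hz : z ∈ sectors c) :
    ∀ᶠ z' in 𝓝 z, round (z'.2 - c) = round (z.2 - c) := by
  rw [mem_sectors_iff] at hz
  have h1 : {z' : I × ℝ | |z'.2 - c - round (z.2 - c)| < 1 / 2} ∈ 𝓝 z :=
    (isOpen_lt (by fun_prop) continuous_const).mem_nhds hz.2
  filter_upwards [h1] with z' hz'
  exact round_eq_of_abs_lt hz'

/-- The contraction of the interior of the polygon to its centre. -/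
noncomputable def innerContraction (hg : 0 < g) : Holonomy.Contraction (proj g) innerRegion where
  isOpen := isOpen_innerRegion
  saturated _ _ h hz := innerRegion_saturated hg h hz
  K q := (unitInterval.symm q.2 * q.1.1, q.1.2)
  continuousOn := by fun_prop
  zero z _ := by simp
  one z _ := by
    refine Filter.Eventually.of_forall fun z' => ?_
    simp only [unitInterval.symm_one, zero_mul]
    exact proj_zero _ _
  compat z hz z' _ s h := by
    -- The criterion needs a function on the whole strip; the value `none` fills in outside the
    -- region.
    have := eq_of_proj_eq hg (fun z : I × ℝ => if z.1 < 1 then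
        some (proj g (unitInterval.symm s * z.1, z.2)) else none)
      (fun t t' => by simpa using proj_zero _ _)
      (fun r t => by simp only [proj_add_period hg])
      (fun j N _ t _ => by simp) h
    have hz' := innerRegion_saturated hg h hz
    rw [if_pos (show z.1 < 1 from hz), if_pos (show z'.1 < 1 from hz')] at this
    exact Option.some_injective _ this

/-- The homotopy that moves the sectors to the centres of their outer sides. -/
noncomputable def sectorHomotopy (c : ℝ) (q : (I × ℝ) × I) : I × ℝ :=
  (unitInterval.symm (unitInterval.symm q.2 * unitInterval.symm q.1.1),
    q.1.2 + q.2 * (centre c q.1.2 - q.1.2))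

theorem centre_period (c t : ℝ) (k : ℤ) : centre c (t + k) = centre c t + k := by
  unfold centre
  rw [show t + k - c = t - c + k by ring, round_add_intCast]
  push_cast
  ring

theorem centre_neg {c : ℝ} {n : ℤ} (hc : 2 * c = n) {r : I} {t : ℝ} (N : ℤ)
    (hz : (r, t) ∈ sectors c) : centre c (N - t) = N - centre c t := by
  rw [mem_sectors_iff] at hz
  have h2 := hz.2
  unfold centre
  have h1 : round ((N : ℝ) - t - c) = N - n - round (t - c) := by
    apply round_eq_of_abs_lt
    rw [abs_sub_comm] at h2
    push_cast
    convert h2 using 2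
    linarith
  rw [h1]
  push_cast
  linarith

/-- Sectors are centred at vertices or at midpoints of sides. A point of a side therefore moves
within that side, and the gluing applies to it at all times. -/
theorem centre_mem_Icc {c : ℝ} {n : ℤ} (hc : 2 * c = n) {r : I} {t : ℝ} {j : ℤ}
    (hz : (r, t) ∈ sectors c) (ht : t ∈ Icc (j : ℝ) (j + 1)) :
    centre c t ∈ Icc (j : ℝ) (j + 1) := by
  rw [mem_sectors_iff] at hz
  have h2 := abs_lt.mp hz.2
  unfold centre
  simp only at h2
  set m := round (t - c)
  -- Twice the centre is the integer `n + 2 * m`, so the strict bounds `2 * j - 1` and `2 * j + 3`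
  -- sharpen to `2 * j` and `2 * j + 2`.
  have h3 : (2 * j - 1 : ℤ) < n + 2 * m := by
    have : ((2 * j - 1 : ℤ) : ℝ) < ((n + 2 * m : ℤ) : ℝ) := by
      push_cast; linarith [h2.1, h2.2, ht.1, ht.2]
    exact_mod_cast this
  have h4 : n + 2 * m < (2 * j + 3 : ℤ) := by
    have : ((n + 2 * m : ℤ) : ℝ) < ((2 * j + 3 : ℤ) : ℝ) := by
      push_cast; linarith [h2.1, h2.2, ht.1, ht.2]
    exact_mod_cast this
  have h5 : ((2 * j : ℤ) : ℝ) ≤ ((n + 2 * m : ℤ) : ℝ) := by exact_mod_cast (by omega)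
  have h6 : ((n + 2 * m : ℤ) : ℝ) ≤ ((2 * j + 2 : ℤ) : ℝ) := by exact_mod_cast (by omega)
  push_cast at h5 h6
  constructor <;> linarith

open Classical in
/-- The contraction of the sectors. -/
noncomputable def sectorContraction (hg : 0 < g) {c : ℝ} {n : ℤ} (hc : 2 * c = n) :
    Holonomy.Contraction (proj g) (sectors c) where
  isOpen := isOpen_sectors c
  saturated _ _ h hz := sectors_saturated hg hc h hz
  K := sectorHomotopy c
  continuousOn := by
    rintro ⟨z, s⟩ ⟨hz, -⟩
    refine ContinuousAt.continuousWithinAt ?_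
    -- The centre is constant near `z`; freezing it there gives a continuous formula that agrees
    -- locally with the homotopy.
    have h1 : ContinuousAt (fun q : (I × ℝ) × I =>
        ((unitInterval.symm (unitInterval.symm q.2 * unitInterval.symm q.1.1),
          q.1.2 + q.2 * (centre c z.2 - q.1.2)) : I × ℝ)) (z, s) := by fun_prop
    refine h1.congr ?_
    have h2 : ∀ᶠ q : (I × ℝ) × I in 𝓝 (z, s), round (q.1.2 - c) = round (z.2 - c) :=
      continuousAt_fst.eventually (eventually_round_eq hz)
    filter_upwards [h2] with q hq
    simp only [sectorHomotopy, centre, hq]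
  zero z _ := by simp [sectorHomotopy]
  one z hz := by
    filter_upwards [eventually_round_eq hz] with z' hz'
    simp [sectorHomotopy, centre, hz']
  compat z hz z' _ s h := by
    have := eq_of_proj_eq hg (fun z : I × ℝ => if z ∈ sectors c then
        some (proj g (sectorHomotopy c (z, s))) else none)
      (fun t t' => by simp [sectors])
      (fun r t => by
        have h1 := mem_sectors_period c r t (4 * g)
        have h2 := centre_period c t (4 * g)
        push_cast at h1 h2
        simp only [h1, sectorHomotopy, h2]
        rw [← proj_add_period hg _ (t + s * (centre c t - t))]
        congr 4
        ring)
      (fun j N hj t ht => by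
        simp only [mem_sectors_neg hc]
        split_ifs with hm
        · simp only [sectorHomotopy, centre_neg hc N hm, unitInterval.symm_one, mul_zero,
            unitInterval.symm_zero]
          have h1 := centre_mem_Icc hc hm ht
          rw [proj_glued hj]
          · congr 3
            ring
          · have hs0 := s.2.1
            have hs1 := s.2.2
            constructor <;> nlinarith [h1.1, h1.2, ht.1, ht.2]
        · rfl) h
    rw [if_pos hz, if_pos (sectors_saturated hg hc h hz)] at this
    exact Option.some_injective _ this

end StandardSurface

/-! ### Potentials on a simply connected source -/

namespace Holonomy

section Potential

variable {X : Type u} [TopologicalSpace X] {G : Type v} [Group G] (F F' : Holonomy X G)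
  {R : Type w} [TopologicalSpace R] [SimplyConnectedSpace R] (Q : C(R, X)) (z₀ : R)

/-- The holonomy from a base point in the simply connected space `R`. -/
noncomputable def potential (z : R) : G :=
  F.val ((PathConnectedSpace.somePath z₀ z).map Q.continuous)

theorem val_map {z z' : R} (p : Path z z') :
    F.val (p.map Q.continuous) = (F.potential Q z₀ z)⁻¹ * F.potential Q z₀ z' := by
  have h := (F.pull Q).val_eq_of_simplyConnected
    ((PathConnectedSpace.somePath z₀ z).trans p) (PathConnectedSpace.somePath z₀ z')
  rw [val_trans] at h
  exact eq_inv_mul_of_mul_eq h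

theorem potential_self : F.potential Q z₀ z₀ = 1 := by
  have h := F.val_map Q z₀ (Path.refl z₀)
  rw [inv_mul_cancel] at h
  have h2 := F.val_map Q z₀ (PathConnectedSpace.somePath z₀ z₀)
  rw [inv_mul_cancel] at h2
  exact h2

theorem potential_eq_of_path {z₁ z₁' z₂ z₂' : R} (p : Path z₁ z₁') (q : Path z₂ z₂')
    (h : ∀ t, Q (p t) = Q (q t)) :
    (F.potential Q z₀ z₁)⁻¹ * F.potential Q z₀ z₁' =
      (F.potential Q z₀ z₂)⁻¹ * F.potential Q z₀ z₂' := by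
  rw [← F.val_map Q z₀ p, ← F.val_map Q z₀ q]
  exact F.val_congr h

/-- By hypothesis the discrepancy of the two potentials descends to a function `m` on `X`. The gauge
transform of `F` by `m` agrees with `F'` on images of paths in `R`, hence everywhere, and it does
not change loops at `Q z₀`, where `m` is `1`. -/
theorem val_loop_eq_of_potential (hQ : IsQuotientMap Q)
    (h : ∀ z z', Q z = Q z' → (F.potential Q z₀ z)⁻¹ * F'.potential Q z₀ z =
      (F.potential Q z₀ z')⁻¹ * F'.potential Q z₀ z')
    {ι : Type*} {W : ι → Set R} (C : ∀ i, Contraction Q (W i)) (hW : ∀ z, ∃ i, z ∈ W i)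
    (p : Path (Q z₀) (Q z₀)) : F.val p = F'.val p := by
  let s := Function.surjInv hQ.surjective
  let m : X → G := fun x => (F.potential Q z₀ (s x))⁻¹ * F'.potential Q z₀ (s x)
  have hm : ∀ z, m (Q z) = (F.potential Q z₀ z)⁻¹ * F'.potential Q z₀ z := fun z =>
    h _ _ (Function.surjInv_eq hQ.surjective _)
  have h1 : (F.twist m).val p = F'.val p := by
    refine (F.twist m).val_eq_of_contractions F' hQ (fun {z z'} q => ?_) C hW p
    change (m (Q z))⁻¹ * F.val (q.map Q.continuous) * m (Q z') = _
    rw [F.val_map Q z₀, F'.val_map Q z₀, hm, hm]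
    group
  rw [← h1]
  change _ = (m (Q z₀))⁻¹ * F.val p * m (Q z₀)
  rw [hm, potential_self, potential_self]
  simp

end Potential

end Holonomy

/-! ### Products of commutators -/

section Words

variable {G : Type v} [Group G] (a b : ℕ → G)

/-- The letters of the infinite word `a₀ b₀ a₀⁻¹ b₀⁻¹ a₁ b₁ a₁⁻¹ b₁⁻¹ ⋯`. -/
def commutatorLetter (k : ℕ) : G :=
  if k % 4 = 0 then a (k / 4) else if k % 4 = 1 then b (k / 4)
  else if k % 4 = 2 then (a (k / 4))⁻¹ else (b (k / 4))⁻¹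

/-- The initial segments of the infinite word `a₀ b₀ a₀⁻¹ b₀⁻¹ a₁ b₁ a₁⁻¹ b₁⁻¹ ⋯`. -/
def commutatorWord : ℕ → G
  | 0 => 1
  | k + 1 => commutatorWord k * commutatorLetter a b k

theorem commutatorWord_one (i : ℕ) :
    commutatorWord a b (4 * i + 1) = commutatorWord a b (4 * i) * a i := by
  simp [commutatorWord, commutatorLetter]

theorem commutatorWord_two (i : ℕ) :
    commutatorWord a b (4 * i + 2) = commutatorWord a b (4 * i + 1) * b i := by
  rw [commutatorWord, commutatorLetter, if_neg (by omega), if_pos (by omega),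
    show (4 * i + 1) / 4 = i by omega]

theorem commutatorWord_three (i : ℕ) :
    commutatorWord a b (4 * i + 3) = commutatorWord a b (4 * i + 2) * (a i)⁻¹ := by
  rw [commutatorWord, commutatorLetter, if_neg (by omega), if_neg (by omega), if_pos (by omega),
    show (4 * i + 2) / 4 = i by omega]

theorem commutatorWord_four (i : ℕ) :
    commutatorWord a b (4 * i + 4) = commutatorWord a b (4 * i + 3) * (b i)⁻¹ := by
  rw [commutatorWord, commutatorLetter, if_neg (by omega), if_neg (by omega), if_neg (by omega),
    show (4 * i + 3) / 4 = i by omega]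

theorem commutatorWord_mul_four (k : ℕ) :
    commutatorWord a b (4 * k) = ((List.range k).map fun i => a i * b i * (a i)⁻¹ * (b i)⁻¹).prod := by
  induction k with
  | zero => rfl
  | succ k ih =>
    rw [List.range_succ, List.map_append, List.prod_append, ← ih, show 4 * (k + 1) = 4 * k + 4 by ring,
      commutatorWord_four, commutatorWord_three, commutatorWord_two, commutatorWord_one]
    simp [mul_assoc]

/-- The solutions of the equation `[a₁, b₁] ⋯ [a_g, b_g] = 1`. -/
def CommutatorSolutions (g : ℕ) (G : Type*) [Group G] : Type _ :=
  {ab : Fin g → G × G //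
    (List.ofFn fun i => (ab i).1 * (ab i).2 * (ab i).1⁻¹ * (ab i).2⁻¹).prod = 1}

end Words

namespace StandardSurface

/-! #### The cocycle of a solution -/

section Cocycle

variable {g : ℕ} {G : Type v} [Group G] (a b : ℕ → G)

/-- The values of the word at the vertices of the polygon, numbered modulo `4 g`. -/
def vertexValue (g : ℕ) (m : ℤ) : G := commutatorWord a b (m % (4 * g)).toNat

/-- The values of the word at the sides of the polygon: those at one of the end points, chosen
compatibly with the gluing. -/
def sideValue (g : ℕ) (m : ℤ) : G := vertexValue a b g (m + if 2 ≤ m % 4 then 1 else 0)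

theorem vertexValue_period (m : ℤ) :
    vertexValue a b g (m + 4 * g) = vertexValue a b g m := by
  simp [vertexValue]

theorem sideValue_period (m : ℤ) :
    sideValue a b g (m + 4 * g) = sideValue a b g m := by
  have h : (m + 4 * (g : ℤ)) % 4 = m % 4 := by omega
  rw [sideValue, h, add_right_comm, vertexValue_period, sideValue]

variable {a b}

theorem vertexValue_eq (hab : commutatorWord a b (4 * g) = 1) {m : ℕ} (hm : m ≤ 4 * g) :
    vertexValue a b g m = commutatorWord a b m := by
  rcases hm.lt_or_eq with h | rfl
  · rw [vertexValue, Int.emod_eq_of_lt (by omega) (by omega), Int.toNat_natCast]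
  · rw [vertexValue, hab]
    push_cast
    simp [commutatorWord]

/-- Glued sides carry mutually inverse letters and are traversed in opposite directions, so the
values at corresponding end points differ by one and the same left factor. -/
theorem vertexValue_glued (hab : commutatorWord a b (4 * g) = 1) {j N : ℤ} (h : IsGlued g j N) :
    vertexValue a b g (N - (j + 1)) * (vertexValue a b g (j + 1))⁻¹ =
      vertexValue a b g (N - j) * (vertexValue a b g j)⁻¹ := by
  obtain ⟨i, hi, ⟨rfl, rfl⟩ | ⟨rfl, rfl⟩⟩ := h
  · rw [show (8 * i + 3 - (4 * i + 1) : ℤ) = (4 * i + 2 : ℕ) by push_cast; ring,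
      show (4 * i + 1 : ℤ) = (4 * i + 1 : ℕ) by push_cast; ring,
      show (8 * i + 3 - 4 * i : ℤ) = (4 * i + 3 : ℕ) by push_cast; ring,
      show (4 * i : ℤ) = (4 * i : ℕ) by push_cast; ring,
      vertexValue_eq hab (by omega), vertexValue_eq hab (by omega), vertexValue_eq hab (by omega),
      vertexValue_eq hab (by omega), commutatorWord_three, commutatorWord_two, commutatorWord_one]
    group
  · rw [show (8 * i + 5 - (4 * i + 1 + 1) : ℤ) = (4 * i + 3 : ℕ) by push_cast; ring,
      show (4 * i + 1 + 1 : ℤ) = (4 * i + 2 : ℕ) by push_cast; ring,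
      show (8 * i + 5 - (4 * i + 1) : ℤ) = (4 * i + 4 : ℕ) by push_cast; ring,
      show (4 * i + 1 : ℤ) = (4 * i + 1 : ℕ) by push_cast; ring,
      vertexValue_eq hab (by omega), vertexValue_eq hab (by omega), vertexValue_eq hab (by omega),
      vertexValue_eq hab (by omega), commutatorWord_four, commutatorWord_three, commutatorWord_two,
      commutatorWord_one]
    group

/-- Sides `0`, `1` modulo `4` take the value at their first vertex, sides `2`, `3` at their last.
For a glued pair these are the vertices `j` and `N - j`, which correspond. -/
theorem sideValue_glued {j N : ℤ} (h : IsGlued g j N) :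
    sideValue a b g (N - j - 1) * (sideValue a b g j)⁻¹ =
      vertexValue a b g (N - j) * (vertexValue a b g j)⁻¹ := by
  have h1 : ¬ 2 ≤ j % 4 ∧ 2 ≤ (N - j - 1) % 4 := by
    obtain ⟨i, hi, ⟨rfl, rfl⟩ | ⟨rfl, rfl⟩⟩ := h <;> omega
  rw [sideValue, sideValue, if_neg h1.1, if_pos h1.2, add_zero, sub_add_cancel]

variable (a b) in
/-- The value of the cocycle on the sectors around the vertices (`false`) and around the sides
(`true`). -/
noncomputable def sectorValue (g : ℕ) : Bool → ℤ → G
  | false => vertexValue a b g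
  | true => sideValue a b g

/-- The offsets of the sectors around the vertices (`false`) and around the sides (`true`). -/
noncomputable def offset : Bool → ℝ
  | false => 0
  | true => 1 / 2

/-- Twice the offset. -/
def offsetTwice : Bool → ℤ
  | false => 0
  | true => 1

theorem two_mul_offset (e : Bool) : 2 * offset e = offsetTwice e := by
  cases e <;> simp [offset, offsetTwice]

/-- The left factor depends on the pair of sides but not on the chart `e`, so it cancels in the
quotients that `Cocycle.compat` compares. -/
theorem sectorValue_glued (hab : commutatorWord a b (4 * g) = 1) (e : Bool) {j N : ℤ}
    (h : IsGlued g j N) {t : ℝ} (ht : t ∈ Icc (j : ℝ) (j + 1)) (hz : ((1 : I), t) ∈ sectors (offset e)) :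
    sectorValue a b g e (round (N - t - offset e)) =
      (vertexValue a b g (N - j) * (vertexValue a b g j)⁻¹) *
        sectorValue a b g e (round (t - offset e)) := by
  have h1 := centre_mem_Icc (two_mul_offset e) hz ht
  have h2 := centre_neg (two_mul_offset e) N hz
  unfold centre at h1 h2
  set m := round (t - offset e)
  set m' := round (N - t - offset e)
  cases e
  · simp only [offset, zero_add] at h1 h2
    have h3 : m' = N - m := by exact_mod_cast h2
    have h4 : m = j ∨ m = j + 1 := by
      have h5 : j ≤ m := by exact_mod_cast h1.1
      have h6 : m ≤ j + 1 := by exact_mod_cast h1.2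
      omega
    rw [h3]
    simp only [sectorValue]
    rcases h4 with h4 | h4 <;> rw [h4]
    · group
    · rw [← vertexValue_glued hab h]
      group
  · simp only [offset] at h1 h2
    have h3 : m' = N - m - 1 := by
      have : (m' : ℝ) = ((N - m - 1 : ℤ) : ℝ) := by push_cast; linarith
      exact_mod_cast this
    have h4 : m = j := by
      have h5 : (j : ℝ) < ((m + 1 : ℤ) : ℝ) := by push_cast; linarith [h1.1]
      have h6 : (m : ℝ) < ((j + 1 : ℤ) : ℝ) := by push_cast; linarith [h1.2]
      have h5' : j < m + 1 := by exact_mod_cast h5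
      have h6' : m < j + 1 := by exact_mod_cast h6
      omega
    rw [h3, h4]
    simp only [sectorValue]
    rw [← sideValue_glued (a := a) (b := b) h]
    group

/-- The three members of the cover of the surface. -/
def region : Option Bool → Set (I × ℝ)
  | none => innerRegion
  | some e => sectors (offset e)

variable (a b) in
/-- The values of the cocycle. -/
noncomputable def regionValue (g : ℕ) : Option Bool → I × ℝ → G
  | none, _ => 1
  | some e, z => sectorValue a b g e (round (z.2 - offset e))

theorem region_cover (z : I × ℝ) : ∃ i, z ∈ region i := by
  rcases cover_regions z with h | h | h
  exacts [⟨none, h⟩, ⟨some false, h⟩, ⟨some true, h⟩]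

theorem region_saturated (hg : 0 < g) (i : Option Bool) {z z' : I × ℝ}
    (h : proj g z = proj g z') (hz : z ∈ region i) : z' ∈ region i := by
  cases i with
  | none => exact innerRegion_saturated hg h hz
  | some e => exact sectors_saturated hg (two_mul_offset e) h hz

theorem region_period (i : Option Bool) (r : I) (t : ℝ) :
    (r, t + 4 * g) ∈ region i ↔ (r, t) ∈ region i := by
  cases i with
  | none => exact Iff.rfl
  | some e =>
    have := mem_sectors_period (offset e) r t (4 * g)
    push_cast at this
    exact this

variable (a b) in
theorem regionValue_period (i : Option Bool) (r : I) (t : ℝ) :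
    regionValue a b g i (r, t + 4 * g) = regionValue a b g i (r, t) := by
  cases i with
  | none => rfl
  | some e =>
    have h : t + 4 * g - offset e = t - offset e + ((4 * g : ℤ) : ℝ) := by push_cast; ring
    simp only [regionValue, h, round_add_intCast]
    cases e
    · exact vertexValue_period a b _
    · exact sideValue_period a b _

open Classical in
/-- The cocycle of a solution of the equation `[a₁, b₁] ⋯ [a_g, b_g] = 1`. -/
noncomputable def cocycle (hg : 0 < g) (hab : commutatorWord a b (4 * g) = 1) :
    Holonomy.Cocycle (proj g) G (Option Bool) where
  W := region
  isOpen i := by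
    cases i with
    | none => exact isOpen_innerRegion
    | some e => exact isOpen_sectors _
  saturated i _ _ h hz := region_saturated hg i h hz
  cover := region_cover
  c := regionValue a b g
  locConst i z hz := by
    cases i with
    | none => exact Filter.Eventually.of_forall fun _ => rfl
    | some e =>
      filter_upwards [eventually_round_eq hz] with z' hz'
      simp only [regionValue, hz']
  compat i j z z' h hi hj := by
    have key := eq_of_proj_eq hg (fun z : I × ℝ => if z ∈ region i ∧ z ∈ region j then
        (regionValue a b g i z)⁻¹ * regionValue a b g j z else 1)
      (fun t t' => by
        cases i with
        | none =>
          cases j with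
          | none => simp [regionValue, region, innerRegion]
          | some e => simp [region, sectors]
        | some e => simp [region, sectors])
      (fun r t => by simp only [region_period, regionValue_period])
      (fun j' N hN t ht => by
        have h1 := region_saturated hg i (proj_glued hN ht)
        have h2 := region_saturated hg i (proj_glued hN ht).symm
        have h3 := region_saturated hg j (proj_glued hN ht)
        have h4 := region_saturated hg j (proj_glued hN ht).symm
        have h5 : ((1 : I), t) ∈ region i ∧ ((1 : I), t) ∈ region j ↔
          ((1 : I), N - t) ∈ region i ∧ ((1 : I), N - t) ∈ region j :=
          ⟨fun h => ⟨h1 h.1, h3 h.2⟩, fun h => ⟨h2 h.1, h4 h.2⟩⟩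
        simp only [← h5]
        split_ifs with h6
        · have h7 : ∀ i, ((1 : I), t) ∈ region i → regionValue a b g i (1, N - t) =
              (vertexValue a b g (N - j') * (vertexValue a b g j')⁻¹) *
                regionValue a b g i (1, t) := by
            rintro (_ | e) hz
            · exact absurd (show (1 : I) < 1 from hz) (lt_irrefl _)
            · exact sectorValue_glued hab e hN ht hz
          rw [h7 i h6.1, h7 j h6.2]
          group
        · rfl) h
    rwa [if_pos ⟨hi, hj⟩, if_pos ⟨region_saturated hg i h hi, region_saturated hg j h hj⟩] at key

end Cocycle

end StandardSurface

theorem contractibleSpace_unitInterval : ContractibleSpace I :=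
  (convex_Icc (0 : ℝ) 1).contractibleSpace ⟨0, by simp⟩

theorem simplyConnectedSpace_polar : SimplyConnectedSpace (I × ℝ) := by
  have := contractibleSpace_unitInterval
  infer_instance

theorem List.ofFn_val_eq_map_range {α : Type*} (n : ℕ) (h : ℕ → α) :
    List.ofFn (fun i : Fin n => h i) = (List.range n).map h := by
  apply List.ext_getElem <;> simp

/-! ### Holonomies on a surface of positive genus and their values on the sides -/

namespace StandardSurface

section Potential

variable {g : ℕ} {G : Type v} [Group G]

attribute [local instance] simplyConnectedSpace_polar

/-- A segment of a circle around the centre of the polygon. -/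
noncomputable def arc (r : I) (t t' : ℝ) : Path ((r, t) : I × ℝ) (r, t') where
  toFun s := (r, t + s * (t' - t))
  continuous_toFun := by fun_prop
  source' := by simp
  target' := by simp

/-- A radial segment. -/
noncomputable def ray (r : I) (t : ℝ) : Path ((0, t) : I × ℝ) (r, t) where
  toFun s := (s * r, t)
  continuous_toFun := by fun_prop
  source' := by simp
  target' := by simp

theorem arc_apply (r : I) (t t' : ℝ) (s : I) : arc r t t' s = (r, t + s * (t' - t)) := rfl

theorem proj_arc_glued {j N : ℤ} (h : IsGlued g j N) {t t' : ℝ} (ht : t ∈ Icc (j : ℝ) (j + 1))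
    (ht' : t' ∈ Icc (j : ℝ) (j + 1)) (s : I) :
    proj g (arc 1 t t' s) = proj g (arc 1 (N - t) (N - t') s) := by
  rw [arc_apply, arc_apply, proj_glued h]
  · congr 2
    ring
  · have hs0 := s.2.1
    have hs1 := s.2.2
    constructor <;> nlinarith [ht.1, ht.2, ht'.1, ht'.2]

variable (F : Holonomy (StandardSurface g) G)

/-- The potential of a holonomy on the surface. -/
noncomputable def pot (z : I × ℝ) : G := F.potential (proj g) (1, 0) z

theorem pot_base : pot F (1, 0) = 1 := F.potential_self _ _

theorem pot_zero (t t' : ℝ) : pot F (0, t) = pot F (0, t') := by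
  have h := F.val_map (proj g) (1, 0) (arc 0 t t')
  rw [F.val_eq_one_of_const (fun s => proj_zero _ _)] at h
  exact inv_mul_eq_one.mp h.symm

/-- The rays at `t` and `t + 4 * g` have the same image, and by `pot_zero` they start from equal
potentials. -/
theorem pot_period (hg : 0 < g) (r : I) (t : ℝ) : pot F (r, t + 4 * g) = pot F (r, t) := by
  have h := F.potential_eq_of_path (proj g) (1, 0) (ray r (t + 4 * g)) (ray r t)
    (fun s => proj_add_period hg _ _)
  change (pot F (0, t + 4 * g))⁻¹ * _ = (pot F (0, t))⁻¹ * _ at h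
  rw [pot_zero F _ t] at h
  exact mul_left_cancel h

theorem pot_glued {j N : ℤ} (h : IsGlued g j N) {t t' : ℝ} (ht : t ∈ Icc (j : ℝ) (j + 1))
    (ht' : t' ∈ Icc (j : ℝ) (j + 1)) :
    (pot F (1, t))⁻¹ * pot F (1, t') = (pot F (1, N - t))⁻¹ * pot F (1, N - t') :=
  F.potential_eq_of_path (proj g) (1, 0) _ _ (proj_arc_glued h ht ht')

theorem val_arc (t t' : ℝ) : F.val ((arc 1 t t').map (proj g).continuous) =
    (pot F (1, t))⁻¹ * pot F (1, t') :=
  F.val_map (proj g) (1, 0) (arc 1 t t')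

/-- The holonomy of the first sides. -/
noncomputable def sideA (i : ℕ) : G :=
  F.val ((arc 1 (4 * i) (4 * i + 1)).map (proj g).continuous)

/-- The holonomy of the second sides. -/
noncomputable def sideB (i : ℕ) : G :=
  F.val ((arc 1 (4 * i + 1) (4 * i + 2)).map (proj g).continuous)

/-- In a block of four sides, the third and fourth are glued backwards to the first and second, so
they contribute the inverse holonomies. -/
theorem pot_vertices (i : ℕ) (hi : i < g)
    (h0 : pot F (1, 4 * i) = commutatorWord (sideA F) (sideB F) (4 * i)) :
    pot F (1, 4 * i + 1) = commutatorWord (sideA F) (sideB F) (4 * i + 1) ∧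
    pot F (1, 4 * i + 2) = commutatorWord (sideA F) (sideB F) (4 * i + 2) ∧
    pot F (1, 4 * i + 3) = commutatorWord (sideA F) (sideB F) (4 * i + 3) ∧
    pot F (1, 4 * i + 4) = commutatorWord (sideA F) (sideB F) (4 * i + 4) := by
  have ha : sideA F i = (pot F (1, 4 * i))⁻¹ * pot F (1, 4 * i + 1) := val_arc F _ _
  have hb : sideB F i = (pot F (1, 4 * i + 1))⁻¹ * pot F (1, 4 * i + 2) := val_arc F _ _
  have hA := pot_glued F (t := 4 * i) (t' := 4 * i + 1) (⟨i, hi, Or.inl ⟨rfl, rfl⟩⟩ : IsGlued g _ _)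
    (by push_cast; constructor <;> linarith) (by push_cast; constructor <;> linarith)
  have hB := pot_glued F (t := 4 * i + 1) (t' := 4 * i + 2)
    (⟨i, hi, Or.inr ⟨rfl, rfl⟩⟩ : IsGlued g _ _)
    (by push_cast; constructor <;> linarith) (by push_cast; constructor <;> linarith)
  push_cast at hA hB
  rw [← ha, show (8 * i + 3 - 4 * i : ℝ) = 4 * i + 3 by ring,
    show (8 * i + 3 - (4 * i + 1) : ℝ) = 4 * i + 2 by ring] at hA
  rw [← hb, show (8 * i + 5 - (4 * i + 1) : ℝ) = 4 * i + 4 by ring,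
    show (8 * i + 5 - (4 * i + 2) : ℝ) = 4 * i + 3 by ring] at hB
  have h1 : pot F (1, 4 * i + 1) = commutatorWord (sideA F) (sideB F) (4 * i + 1) := by
    rw [commutatorWord_one, ← h0, ha, mul_inv_cancel_left]
  have h2 : pot F (1, 4 * i + 2) = commutatorWord (sideA F) (sideB F) (4 * i + 2) := by
    rw [commutatorWord_two, ← h1, hb, mul_inv_cancel_left]
  have h3 : pot F (1, 4 * i + 3) = commutatorWord (sideA F) (sideB F) (4 * i + 3) := by
    rw [commutatorWord_three, ← h2, hA]
    group
  have h4 : pot F (1, 4 * i + 4) = commutatorWord (sideA F) (sideB F) (4 * i + 4) := by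
    rw [commutatorWord_four, ← h3, hB]
    group
  exact ⟨h1, h2, h3, h4⟩

theorem pot_vertex_four (i : ℕ) (hi : i ≤ g) :
    pot F (1, 4 * i) = commutatorWord (sideA F) (sideB F) (4 * i) := by
  induction i with
  | zero => simpa [commutatorWord] using pot_base F
  | succ i ih =>
    have h := (pot_vertices F i (by omega) (ih (by omega))).2.2.2
    push_cast
    rw [show (4 * (i + 1) : ℝ) = 4 * i + 4 by ring, show 4 * (i + 1) = 4 * i + 4 by ring]
    exact h

/-- After a full turn the potential returns to its initial value `1`. -/
theorem commutatorWord_sides (hg : 0 < g) :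
    commutatorWord (sideA F) (sideB F) (4 * g) = 1 := by
  rw [← pot_vertex_four F g le_rfl, ← pot_base F, ← pot_period F hg 1 0, zero_add]

/-- The gluings identify the vertices in the chain 4i, 4i+3, 4i+2, 4i+1, 4i+4; this makes every side
a loop. -/
theorem proj_vertices (i : ℕ) (hi : i < g) (h0 : proj g (1, 4 * i) = proj g (1, 0)) :
    proj g (1, 4 * i + 1) = proj g (1, 0) ∧ proj g (1, 4 * i + 2) = proj g (1, 0) ∧
    proj g (1, 4 * i + 4) = proj g (1, 0) := by
  have hA := fun t ht => proj_glued (⟨i, hi, Or.inl ⟨rfl, rfl⟩⟩ : IsGlued g _ _) (t := t) ht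
  have hB := fun t ht => proj_glued (⟨i, hi, Or.inr ⟨rfl, rfl⟩⟩ : IsGlued g _ _) (t := t) ht
  push_cast at hA hB
  have h1 := hA (4 * i) (by constructor <;> linarith)
  have h2 := hA (4 * i + 1) (by constructor <;> linarith)
  have h3 := hB (4 * i + 1) (by constructor <;> linarith)
  have h4 := hB (4 * i + 2) (by constructor <;> linarith)
  rw [show (8 * i + 3 - 4 * i : ℝ) = 4 * i + 3 by ring] at h1
  rw [show (8 * i + 3 - (4 * i + 1) : ℝ) = 4 * i + 2 by ring] at h2
  rw [show (8 * i + 5 - (4 * i + 1) : ℝ) = 4 * i + 4 by ring] at h3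
  rw [show (8 * i + 5 - (4 * i + 2) : ℝ) = 4 * i + 3 by ring] at h4
  have h5 : proj g (1, 4 * i + 2) = proj g (1, 0) := by rw [h4, ← h1, h0]
  have h6 : proj g (1, 4 * i + 1) = proj g (1, 0) := by rw [h2, h5]
  exact ⟨h6, h5, by rw [← h3, h6]⟩

theorem proj_vertex_four (i : ℕ) (hi : i ≤ g) : proj g (1, 4 * i) = proj g (1, 0) := by
  induction i with
  | zero => simp
  | succ i ih =>
    have h := (proj_vertices i (by omega) (ih (by omega))).2.2
    push_cast
    rw [show (4 * (i + 1) : ℝ) = 4 * i + 4 by ring]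
    exact h

/-- The loops given by the first sides. -/
noncomputable def loopA (i : Fin g) : Path (proj g (1, 0)) (proj g (1, 0)) :=
  ((arc 1 (4 * (i : ℕ)) (4 * (i : ℕ) + 1)).map (proj g).continuous).cast
    (proj_vertex_four i i.2.le).symm (proj_vertices i i.2 (proj_vertex_four i i.2.le)).1.symm

/-- The loops given by the second sides. -/
noncomputable def loopB (i : Fin g) : Path (proj g (1, 0)) (proj g (1, 0)) :=
  ((arc 1 (4 * (i : ℕ) + 1) (4 * (i : ℕ) + 2)).map (proj g).continuous).cast
    (proj_vertices i i.2 (proj_vertex_four i i.2.le)).1.symm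
    (proj_vertices i i.2 (proj_vertex_four i i.2.le)).2.1.symm

theorem val_loopA (i : Fin g) : F.val (loopA i) = sideA F i := F.val_congr fun _ => rfl

theorem val_loopB (i : Fin g) : F.val (loopB i) = sideB F i := F.val_congr fun _ => rfl

theorem prod_loops (hg : 0 < g) : (List.ofFn fun i : Fin g => F.val (loopA i) * F.val (loopB i) *
    (F.val (loopA i))⁻¹ * (F.val (loopB i))⁻¹).prod = 1 := by
  simp only [val_loopA, val_loopB]
  rw [List.ofFn_val_eq_map_range g fun i => sideA F i * sideB F i * (sideA F i)⁻¹ * (sideB F i)⁻¹,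
    ← commutatorWord_mul_four, commutatorWord_sides F hg]

theorem commutatorWord_congr {a b a' b' : ℕ → G} {k : ℕ} (ha : ∀ i, 4 * i < k → a i = a' i)
    (hb : ∀ i, 4 * i + 1 < k → b i = b' i) : commutatorWord a b k = commutatorWord a' b' k := by
  induction k with
  | zero => rfl
  | succ k ih =>
    rw [commutatorWord, commutatorWord, ih (fun i hi => ha i (by omega)) fun i hi => hb i (by omega)]
    congr 1
    unfold commutatorLetter
    split_ifs
    · exact ha _ (by omega)
    · exact hb _ (by omega)
    · rw [ha _ (by omega)]
    · rw [hb _ (by omega)]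

/-- A holonomy is determined by its values on the sides of the polygon. -/
theorem val_loop_eq (hg : 0 < g) (F' : Holonomy (StandardSurface g) G)
    (hA : ∀ i : Fin g, F.val (loopA i) = F'.val (loopA i))
    (hB : ∀ i : Fin g, F.val (loopB i) = F'.val (loopB i))
    (p : Path (proj g (1, 0)) (proj g (1, 0))) : F.val p = F'.val p := by
  simp only [val_loopA, val_loopB] at hA hB
  have hw : ∀ k, k ≤ 4 * g → commutatorWord (sideA F) (sideB F) k =
      commutatorWord (sideA F') (sideB F') k := fun k hk =>
    commutatorWord_congr (fun i hi => hA ⟨i, by omega⟩) fun i hi => hB ⟨i, by omega⟩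
  have hv : ∀ j N, IsGlued g j N → pot F (1, j) = pot F' (1, j) ∧
      pot F (1, N - j) = pot F' (1, N - j) := by
    rintro _ _ ⟨i, hi, ⟨rfl, rfl⟩ | ⟨rfl, rfl⟩⟩
    · have h0 := pot_vertex_four F i hi.le
      have h0' := pot_vertex_four F' i hi.le
      have h1 := (pot_vertices F i hi h0).2.2.1
      have h1' := (pot_vertices F' i hi h0').2.2.1
      push_cast
      rw [show (8 * i + 3 - 4 * i : ℝ) = 4 * i + 3 by ring, h0, h0', h1, h1']
      exact ⟨hw _ (by omega), hw _ (by omega)⟩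
    · have h0 := pot_vertex_four F i hi.le
      have h0' := pot_vertex_four F' i hi.le
      have h1 := pot_vertices F i hi h0
      have h1' := pot_vertices F' i hi h0'
      push_cast
      rw [show (8 * i + 5 - (4 * i + 1) : ℝ) = 4 * i + 4 by ring, h1.1, h1'.1, h1.2.2.2,
        h1'.2.2.2]
      exact ⟨hw _ (by omega), hw _ (by omega)⟩
  let C : ∀ i : Option Bool, Holonomy.Contraction (proj g) (region i)
    | none => innerContraction hg
    | some e => sectorContraction hg (two_mul_offset e)
  refine F.val_loop_eq_of_potential F' (proj g) (1, 0) (isQuotientMap_proj hg) (fun z z' h => ?_)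
    C region_cover p
  refine eq_of_proj_eq hg (fun z => (pot F z)⁻¹ * pot F' z) (fun t t' => ?_) (fun r t => ?_)
    (fun j N hj t ht => ?_) h
  · simp only [pot_zero _ t t']
  · simp only [pot_period _ hg]
  -- Each potential changes by equal amounts along the two glued sides, so the agreement of the
  -- potentials at the vertices `j` and `N - j` controls the discrepancy along both sides.
  · have hj0 : (j : ℝ) ∈ Icc (j : ℝ) (j + 1) := by constructor <;> linarith
    have h1 := pot_glued F hj ht hj0
    have h2 := pot_glued F' hj ht hj0
    obtain ⟨h3, h4⟩ := hv j N hj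
    rw [← h3, ← h4] at h2
    have h5 := congrArg₂ (fun x y : G => x * y⁻¹) h1 h2
    simpa [mul_assoc] using h5

/-- There is a holonomy with prescribed values on the sides of the polygon. -/
theorem exists_holonomy (hg : 0 < g) (ab : CommutatorSolutions g G) :
    ∃ F : Holonomy (StandardSurface g) G, ∀ i : Fin g,
      F.val (loopA i) = (ab.1 i).1 ∧ F.val (loopB i) = (ab.1 i).2 := by
  let a : ℕ → G := fun i => if h : i < g then (ab.1 ⟨i, h⟩).1 else 1
  let b : ℕ → G := fun i => if h : i < g then (ab.1 ⟨i, h⟩).2 else 1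
  have ha : ∀ i : Fin g, a i = (ab.1 i).1 := fun i => by simp [a]
  have hb : ∀ i : Fin g, b i = (ab.1 i).2 := fun i => by simp [b]
  have hab : commutatorWord a b (4 * g) = 1 := by
    rw [commutatorWord_mul_four, ← List.ofFn_val_eq_map_range]
    simp only [ha, hb]
    exact ab.2
  obtain ⟨F, hF⟩ := (cocycle hg hab).exists_holonomy (isQuotientMap_proj hg) (proj g).continuous
  -- A vertex lies only in the sectors of offset `0`: it has radius `1`, and an integral angle is
  -- excluded from offset `1 / 2`. The chosen chart is thus forced.
  have hval : ∀ k : ℕ, k ≤ 4 * g → (cocycle hg hab).c ((cocycle hg hab).index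
      (isQuotientMap_proj hg) (proj g (1, (k : ℝ)))) (1, (k : ℝ)) = commutatorWord a b k := by
    intro k hk
    have hm := (cocycle hg hab).mem_index (isQuotientMap_proj hg) (1, (k : ℝ))
    rcases h : (cocycle hg hab).index (isQuotientMap_proj hg) (proj g (1, (k : ℝ))) with _ | e
    · rw [h] at hm
      exact absurd (show (1 : I) < 1 from hm) (lt_irrefl _)
    · cases e
      · change vertexValue a b g (round ((k : ℝ) - 0)) = _
        rw [sub_zero, round_natCast, vertexValue_eq hab hk]
      · rw [h] at hm
        obtain ⟨-, m, hm⟩ := hm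
        rw [abs_lt] at hm
        simp only [offset] at hm
        exfalso
        have h1 : (m : ℝ) < ((k : ℤ) : ℝ) := by push_cast; linarith [hm.2]
        have h2 : ((k : ℤ) : ℝ) < ((m + 1 : ℤ) : ℝ) := by push_cast; linarith [hm.1]
        have h1' : m < k := by exact_mod_cast h1
        have h2' : (k : ℤ) < m + 1 := by exact_mod_cast h2
        omega
  have hside : ∀ k : ℕ, k < 4 * g → F.val ((arc 1 (k : ℝ) ((k + 1 : ℕ) : ℝ)).map
      (proj g).continuous) = (commutatorWord a b k)⁻¹ * commutatorWord a b (k + 1) := by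
    intro k hk
    rw [hF, hval k hk.le, hval (k + 1) hk]
  refine ⟨F, fun i => ⟨?_, ?_⟩⟩
  · have h := hside (4 * i) (by omega)
    rw [commutatorWord_one, inv_mul_cancel_left, ha] at h
    rw [← h]
    refine F.val_congr fun t => congrArg (proj g) ?_
    rw [arc_apply, arc_apply]
    push_cast
    rfl
  · have h := hside (4 * i + 1) (by omega)
    rw [commutatorWord_two, inv_mul_cancel_left, hb] at h
    rw [← h]
    refine F.val_congr fun t => congrArg (proj g) ?_
    rw [arc_apply, arc_apply]
    push_cast
    congr 1
    ring

theorem pathConnectedSpace (g : ℕ) : PathConnectedSpace (StandardSurface g) := by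
  have : PathConnectedSpace ClosedDisc := by
    rw [← isPathConnected_iff_pathConnectedSpace]
    exact (convex_closedBall (0 : ℂ) 1).isPathConnected ⟨0, by simp⟩
  exact (Quot.mk_surjective.pathConnectedSpace continuous_quot_mk)

/-- Homomorphisms from the fundamental group of the surface are solutions of the equation
`[a₁, b₁] ⋯ [a_g, b_g] = 1`. -/
theorem nonempty_hom_equiv_of_pos (hg : 0 < g) :
    Nonempty ((FundamentalGroup (StandardSurface g) (proj g (1, 0)) →* G) ≃
      CommutatorSolutions g G) := by
  have := pathConnectedSpace g
  let Φ : (FundamentalGroup (StandardSurface g) (proj g (1, 0)) →* G) → CommutatorSolutions g G :=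
    fun φ => ⟨fun i => ((Holonomy.ofHom φ).val (loopA i), (Holonomy.ofHom φ).val (loopB i)),
      prod_loops (Holonomy.ofHom φ) hg⟩
  refine ⟨Equiv.ofBijective Φ ⟨fun φ ψ h => ?_, fun ab => ?_⟩⟩
  · have h1 := fun i => congr_fun (congrArg Subtype.val h) i
    rw [← Holonomy.toHom_ofHom φ, ← Holonomy.toHom_ofHom ψ]
    ext x
    obtain ⟨p, rfl⟩ := Path.Homotopic.Quotient.mk_surjective x
    refine congrArg (·⁻¹) (val_loop_eq (Holonomy.ofHom φ) hg (Holonomy.ofHom ψ) (fun i => ?_)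
      (fun i => ?_) p)
    · exact congrArg Prod.fst (h1 i)
    · exact congrArg Prod.snd (h1 i)
  · obtain ⟨F, hF⟩ := exists_holonomy hg ab
    refine ⟨F.toHom _, Subtype.ext (funext fun i => ?_)⟩
    have h : ∀ p, (Holonomy.ofHom (F.toHom (proj g (1, 0)))).val p = F.val p := fun p => by
      rw [Holonomy.ofHom_val, Holonomy.toHom_mk, inv_inv]
    exact Prod.ext ((h _).trans (hF i).1) ((h _).trans (hF i).2)

end Potential

end StandardSurface

/-! #### The sphere -/

namespace StandardSurface

section Sphere

variable {G : Type v} [Group G]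

/-- The quotient map from the disc to the sphere. -/
noncomputable def sphereProj : C(ClosedDisc, StandardSurface 0) :=
  ⟨fun z => Quot.mk _ z, continuous_quot_mk⟩

theorem isQuotientMap_sphereProj : IsQuotientMap sphereProj := isQuotientMap_quot_mk

theorem sphereProj_eq {z w : ClosedDisc} (hz : ‖(z : ℂ)‖ = 1) (hw : ‖(w : ℂ)‖ = 1) :
    sphereProj z = sphereProj w :=
  Quot.sound (SurfaceRel.sphere rfl z w hz hw)

theorem eq_of_sphereProj_eq {Y : Type*} (h : ClosedDisc → Y)
    (hb : ∀ z w : ClosedDisc, ‖(z : ℂ)‖ = 1 → ‖(w : ℂ)‖ = 1 → h z = h w) {z w : ClosedDisc}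
    (hzw : sphereProj z = sphereProj w) : h z = h w := by
  let q : StandardSurface 0 → Y := Quot.lift h (by
    rintro _ _ (⟨i, _, _⟩ | ⟨i, _, _⟩ | ⟨_, z, w, hz, hw⟩)
    · exact i.elim0
    · exact i.elim0
    · exact hb _ _ hz hw)
  exact congrArg q hzw

/-- The multiple of a point of the disc by a real number between `0` and `1`. -/
noncomputable def shrink (q : ClosedDisc × I) : ClosedDisc :=
  ⟨((unitInterval.symm q.2 : I) : ℝ) * (q.1 : ℂ), by
    have h1 := mem_closedBall_zero_iff.mp q.1.2
    rw [mem_closedBall_zero_iff, norm_mul, Complex.norm_real,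
      Real.norm_of_nonneg (unitInterval.symm q.2).2.1]
    exact mul_le_one₀ (unitInterval.symm q.2).2.2 (norm_nonneg _) h1⟩

/-- The radial motion of the points of the punctured disc to the boundary. -/
noncomputable def expand (q : ClosedDisc × I) : ClosedDisc :=
  ⟨((1 - q.2 + q.2 / ‖(q.1 : ℂ)‖ : ℝ) : ℂ) * (q.1 : ℂ), by
    have h1 := mem_closedBall_zero_iff.mp q.1.2
    have hs0 := q.2.2.1
    have hs1 := q.2.2.2
    rw [mem_closedBall_zero_iff]
    rcases eq_or_ne (q.1 : ℂ) 0 with h | h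
    · rw [h, mul_zero, norm_zero]
      exact zero_le_one
    · have h2 : 0 < ‖(q.1 : ℂ)‖ := norm_pos_iff.mpr h
      have h3 : 0 ≤ (q.2 : ℝ) / ‖(q.1 : ℂ)‖ := by positivity
      rw [norm_mul, Complex.norm_real, Real.norm_of_nonneg (by linarith), add_mul,
        div_mul_cancel₀ _ h2.ne']
      nlinarith⟩

theorem norm_expand {q : ClosedDisc × I} (h : (q.1 : ℂ) ≠ 0) :
    ‖(expand q : ℂ)‖ = (1 - q.2) * ‖(q.1 : ℂ)‖ + q.2 := by
  have hs0 := q.2.2.1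
  have hs1 := q.2.2.2
  have h2 : 0 < ‖(q.1 : ℂ)‖ := norm_pos_iff.mpr h
  have h3 : 0 ≤ (q.2 : ℝ) / ‖(q.1 : ℂ)‖ := by positivity
  change ‖((1 - q.2 + q.2 / ‖(q.1 : ℂ)‖ : ℝ) : ℂ) * (q.1 : ℂ)‖ = _
  rw [norm_mul, Complex.norm_real, Real.norm_of_nonneg (by linarith), add_mul,
    div_mul_cancel₀ _ h2.ne']

/-- The contraction of the open disc. -/
noncomputable def shrinkContraction :
    Holonomy.Contraction sphereProj {z : ClosedDisc | ‖(z : ℂ)‖ < 1} where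
  isOpen := isOpen_lt (by fun_prop) continuous_const
  saturated z z' h hz := by
    have := eq_of_sphereProj_eq (fun z => ‖(z : ℂ)‖ < 1) (fun z w hz hw => by simp [hz, hw]) h
    exact this.mp hz
  K := shrink
  continuousOn := by
    refine Continuous.continuousOn ?_
    unfold shrink
    fun_prop
  zero z _ := by
    ext
    simp [shrink]
  one z _ := by
    refine Filter.Eventually.of_forall fun z' => congrArg _ ?_
    ext
    simp [shrink]
  compat z hz z' hz' s h := by
    have := eq_of_sphereProj_eq (fun z => if ‖(z : ℂ)‖ < 1 then
      some (sphereProj (shrink (z, s))) else none) (fun z w hz hw => by simp [hz, hw]) h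
    rw [if_pos (show ‖(z : ℂ)‖ < 1 from hz), if_pos (show ‖(z' : ℂ)‖ < 1 from hz')] at this
    exact Option.some_injective _ this

/-- The contraction of the punctured disc. -/
noncomputable def expandContraction :
    Holonomy.Contraction sphereProj {z : ClosedDisc | (z : ℂ) ≠ 0} where
  isOpen := isOpen_ne_fun (by fun_prop) continuous_const
  saturated z z' h hz := by
    have := eq_of_sphereProj_eq (fun z => (z : ℂ) ≠ 0) (fun z w hz hw => by
      have h1 : (z : ℂ) ≠ 0 := fun h => by simp [h] at hz
      have h2 : (w : ℂ) ≠ 0 := fun h => by simp [h] at hw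
      simp [h1, h2]) h
    exact this.mp hz
  K := expand
  continuousOn := by
    unfold expand
    refine continuousOn_iff_continuous_domRestrict.mpr (Continuous.subtype_mk ?_ _)
    refine Continuous.mul (Complex.continuous_ofReal.comp (Continuous.add (by fun_prop)
      (Continuous.div (by fun_prop) (by fun_prop) fun q => ?_))) (by fun_prop)
    exact norm_ne_zero_iff.mpr q.2.1
  zero z _ := by
    ext
    simp [expand]
  one z hz := by
    have h1 : ∀ᶠ z' : ClosedDisc in 𝓝 z, (z' : ℂ) ≠ 0 :=
      (isOpen_ne_fun (by fun_prop) continuous_const).mem_nhds hz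
    filter_upwards [h1] with z' hz'
    -- At time `1` every point has reached the boundary circle, which is a single point of the
    -- sphere.
    refine sphereProj_eq ?_ ?_
    · rw [norm_expand hz']; simp
    · rw [norm_expand (show (z : ℂ) ≠ 0 from hz)]; simp
  compat z hz z' hz' s h := by
    refine eq_of_sphereProj_eq (fun z => sphereProj (expand (z, s))) (fun z w hz hw => ?_) h
    refine sphereProj_eq ?_ ?_
    · rw [norm_expand (norm_ne_zero_iff.mp (by simp [hz]))]; simp [hz]
    · rw [norm_expand (norm_ne_zero_iff.mp (by simp [hw]))]; simp [hw]

theorem simplyConnectedSpace_closedDisc : SimplyConnectedSpace ClosedDisc := by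
  have : ContractibleSpace ClosedDisc :=
    (convex_closedBall (0 : ℂ) 1).contractibleSpace ⟨0, by simp⟩
  infer_instance

theorem exists_boundary_path {z w : ClosedDisc} (hz : ‖(z : ℂ)‖ = 1) (hw : ‖(w : ℂ)‖ = 1) :
    ∃ p : Path z w, ∀ t, ‖(p t : ℂ)‖ = 1 := by
  have key : ∀ z : ClosedDisc, ‖(z : ℂ)‖ = 1 → Complex.exp ((z : ℂ).arg * Complex.I) = z := by
    intro z hz
    have := Complex.norm_mul_exp_arg_mul_I (z : ℂ)
    rwa [hz, Complex.ofReal_one, one_mul] at this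
  refine ⟨⟨⟨fun t => ⟨Complex.exp
    (((z : ℂ).arg + t * ((w : ℂ).arg - (z : ℂ).arg) : ℝ) * Complex.I), by
      rw [mem_closedBall_zero_iff, Complex.norm_exp_ofReal_mul_I]⟩, by fun_prop⟩, ?_, ?_⟩,
      fun t => Complex.norm_exp_ofReal_mul_I _⟩
  · ext
    simp [key z hz]
  · ext
    simp [key w hw]

/-- The trivial holonomy. -/
def trivialHolonomy (X : Type u) [TopologicalSpace X] (G : Type v) [Group G] : Holonomy X G where
  val _ := 1
  val_trans _ _ := by simp
  val_homotopic _ := rfl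

/-- The disc is simply connected, and arcs of its boundary map to a constant path, so the potential
is constant on the boundary. Comparison with the trivial holonomy over the open disc and the
punctured disc gives the result. -/
theorem sphere_val_eq_one (F : Holonomy (StandardSurface 0) G) (z₀ : ClosedDisc)
    (p : Path (sphereProj z₀) (sphereProj z₀)) : F.val p = 1 := by
  have := simplyConnectedSpace_closedDisc
  let C : ∀ i : Bool, Holonomy.Contraction sphereProj
      (if i then {z : ClosedDisc | ‖(z : ℂ)‖ < 1} else {z : ClosedDisc | (z : ℂ) ≠ 0})
    | true => shrinkContraction
    | false => expandContraction
  refine F.val_loop_eq_of_potential (trivialHolonomy _ G) sphereProj z₀ isQuotientMap_sphereProj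
    (fun z z' h => ?_) C (fun z => ?_) p
  · refine eq_of_sphereProj_eq (fun z => (F.potential sphereProj z₀ z)⁻¹ *
      (trivialHolonomy _ G).potential sphereProj z₀ z) (fun z w hz hw => ?_) h
    obtain ⟨p, hp⟩ := exists_boundary_path hz hw
    have h1 := F.val_map sphereProj z₀ p
    rw [F.val_eq_one_of_const (fun t => sphereProj_eq (hp t) hz)] at h1
    simp only [inv_mul_eq_one.mp h1.symm]
    rfl
  · by_cases hz : (z : ℂ) = 0
    · exact ⟨true, by simp [hz]⟩
    · exact ⟨false, by simpa using hz⟩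

theorem nonempty_hom_equiv_zero :
    Nonempty ((FundamentalGroup (StandardSurface 0) (sphereProj ⟨0, by simp⟩) →* G) ≃
      CommutatorSolutions 0 G) := by
  have := pathConnectedSpace 0
  have h1 : ∀ φ : FundamentalGroup (StandardSurface 0) (sphereProj ⟨0, by simp⟩) →* G, φ = 1 := by
    intro φ
    ext x
    obtain ⟨p, rfl⟩ := Path.Homotopic.Quotient.mk_surjective x
    have h2 := sphere_val_eq_one (Holonomy.ofHom φ) _ p
    rw [Holonomy.ofHom_val, inv_eq_one] at h2
    exact h2
  have : Unique (FundamentalGroup (StandardSurface 0) (sphereProj ⟨0, by simp⟩) →* G) :=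
    ⟨⟨1⟩, h1⟩
  have : Unique (CommutatorSolutions 0 G) :=
    ⟨⟨⟨fun i => i.elim0, by simp⟩⟩, fun x => Subtype.ext (funext fun i => i.elim0)⟩
  exact ⟨Equiv.ofUnique _ _⟩

end Sphere

end StandardSurface

/-! #### Surfaces -/

theorem FundamentalGroup.map_bijective {X : Type u} {Y : Type v} [TopologicalSpace X]
    [TopologicalSpace Y] (e : X ≃ₜ Y) (x : X) :
    Function.Bijective (FundamentalGroup.map (e : C(X, Y)) x) := by
  constructor
  · intro a b h
    obtain ⟨p, rfl⟩ := Path.Homotopic.Quotient.mk_surjective a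
    obtain ⟨q, rfl⟩ := Path.Homotopic.Quotient.mk_surjective b
    have h1 : (p.map e.continuous).Homotopic (q.map e.continuous) :=
      Path.Homotopic.Quotient.exact h
    have h2 := (h1.map (e.symm : C(Y, X))).pathCast (e.symm_apply_apply x).symm
      (e.symm_apply_apply x).symm
    refine Path.Homotopic.Quotient.eq.mpr ?_
    convert h2 using 1 <;> ext t <;> simp
  · intro b
    obtain ⟨q, rfl⟩ := Path.Homotopic.Quotient.mk_surjective b
    refine ⟨FundamentalGroup.fromPath (Path.Homotopic.Quotient.mk
      ((q.map e.symm.continuous).cast (e.symm_apply_apply x).symm (e.symm_apply_apply x).symm)), ?_⟩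
    refine congrArg Path.Homotopic.Quotient.mk ?_
    ext t
    simp

/-- Homomorphisms from the fundamental group of a closed orientable surface to a group correspond
to the solutions of the equation `[a₁, b₁] ⋯ [a_g, b_g] = 1`. -/
theorem IsClosedOrientableSurface.nonempty_hom_equiv {g : ℕ} {S : Type u} [TopologicalSpace S]
    (hS : IsClosedOrientableSurface g S) (x : S) (G : Type v) [Group G] :
    Nonempty ((FundamentalGroup S x →* G) ≃ CommutatorSolutions g G) := by
  obtain ⟨e⟩ := hS
  have := StandardSurface.pathConnectedSpace g
  have h : ∃ y : StandardSurface g, Nonempty ((FundamentalGroup (StandardSurface g) y →* G) ≃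
      CommutatorSolutions g G) := by
    rcases Nat.eq_zero_or_pos g with rfl | hg
    · exact ⟨_, StandardSurface.nonempty_hom_equiv_zero⟩
    · exact ⟨_, StandardSurface.nonempty_hom_equiv_of_pos hg⟩
  obtain ⟨y, ⟨f⟩⟩ := h
  let e₁ := MulEquiv.ofBijective _ (FundamentalGroup.map_bijective e x)
  let e₂ := e₁.trans (FundamentalGroup.fundamentalGroupMulEquivOfPathConnected (e x) y)
  exact ⟨(MulEquiv.monoidHomCongrLeftEquiv e₂).trans f⟩

/-! ### Irreducible representations of products of matrix algebras -/

section MatrixProducts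

variable {A : Type u} [Ring A] [Algebra ℂ A] {ι : Type v} [DecidableEq ι] {d : ι → ℕ}
  (e : A ≃ₐ[ℂ] Π i, Matrix (Fin (d i)) (Fin (d i)) ℂ)

/-- The element of the algebra with a given component and all other components zero. -/
def ofComponent (i : ι) (M : Matrix (Fin (d i)) (Fin (d i)) ℂ) : A := e.symm (Pi.single i M)

theorem apply_ofComponent_same (i : ι) (M : Matrix (Fin (d i)) (Fin (d i)) ℂ) :
    e (ofComponent e i M) i = M := by
  simp [ofComponent]

theorem mul_ofComponent (a : A) (i : ι) (M : Matrix (Fin (d i)) (Fin (d i)) ℂ) :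
    a * ofComponent e i M = ofComponent e i (e a i * M) := by
  apply e.injective
  funext j
  rw [map_mul, ofComponent, ofComponent, e.apply_symm_apply, e.apply_symm_apply, Pi.mul_apply]
  rcases eq_or_ne j i with rfl | h
  · simp
  · simp [h]

theorem ofComponent_add (i : ι) (M N : Matrix (Fin (d i)) (Fin (d i)) ℂ) :
    ofComponent e i (M + N) = ofComponent e i M + ofComponent e i N := by
  simp [ofComponent, Pi.single_add]

theorem ofComponent_smul (i : ι) (c : ℂ) (M : Matrix (Fin (d i)) (Fin (d i)) ℂ) :
    ofComponent e i (c • M) = c • ofComponent e i M := by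
  simp [ofComponent, Pi.single_smul]

theorem sum_ofComponent [Fintype ι] : ∑ i, ∑ k, ofComponent e i (Matrix.single k k 1) = 1 := by
  apply e.injective
  rw [map_one, map_sum]
  funext j
  rw [Finset.sum_apply, Finset.sum_eq_single j]
  · rw [map_sum, Finset.sum_apply]
    simp only [apply_ofComponent_same, Pi.one_apply]
    ext a b
    rw [Matrix.sum_apply, Matrix.one_apply]
    simp only [Matrix.single_apply]
    split_ifs with h
    · subst h
      simp
    · refine Finset.sum_eq_zero fun x _ => if_neg ?_
      rintro ⟨rfl, rfl⟩
      exact h rfl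
  · intro i _ hi
    rw [map_sum, Finset.sum_apply]
    exact Finset.sum_eq_zero fun k _ => by simp [ofComponent, hi.symm]
  · simp

/-- The irreducible representation on column vectors given by a factor. -/
noncomputable def matrixIrrep (hd : ∀ i, 0 < d i) (i : ι) : AlgIrrep A where
  dim := d i
  rep := (Matrix.toLinAlgEquiv' : Matrix (Fin (d i)) (Fin (d i)) ℂ ≃ₐ[ℂ] _).toAlgHom.comp
    ((Pi.evalAlgHom ℂ (fun i => Matrix (Fin (d i)) (Fin (d i)) ℂ) i).comp e.toAlgHom)
  dim_pos := hd i
  irreducible W hW := by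
    rw [or_iff_not_imp_left]
    intro hne
    obtain ⟨v, hv, hv0⟩ := Submodule.exists_mem_ne_zero_of_ne_bot hne
    obtain ⟨k, hk⟩ := Function.ne_iff.mp hv0
    rw [eq_top_iff]
    intro w _
    -- This rank-one matrix sends `v` to the arbitrary vector `w`.
    have h := hW (ofComponent e i (Matrix.vecMulVec w (Pi.single k (v k)⁻¹))) v hv
    change (e (ofComponent e i (Matrix.vecMulVec w (Pi.single k (v k)⁻¹))) i).mulVec v ∈ W at h
    rw [apply_ofComponent_same, Matrix.vecMulVec_mulVec, single_dotProduct] at h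
    rw [inv_mul_cancel₀ hk] at h
    simpa using h

/-- The central idempotent of the factor `i` acts as the identity on one representation and, if `j ≠
i`, as zero on the other. -/
theorem eq_of_matrixIrrep_equiv (hd : ∀ i, 0 < d i) {i j : ι}
    (h : (algIrrepSetoid A).r (matrixIrrep e hd i) (matrixIrrep e hd j)) : i = j := by
  obtain ⟨f, hf⟩ := h
  by_contra hij
  let v : Fin (d i) → ℂ := fun _ => 1
  have h1 : f ((e (ofComponent e i 1) i).mulVec v) = (e (ofComponent e i 1) j).mulVec (f v) :=
    hf (ofComponent e i 1) v
  have h2 : e (ofComponent e i 1) j = 0 := by simp [ofComponent, Ne.symm hij]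
  have h4 : (e (ofComponent e i 1) i).mulVec v = v := by
    rw [apply_ofComponent_same, Matrix.one_mulVec]
  have h3 : v = 0 := by
    apply f.injective
    refine Eq.trans (Eq.trans (congrArg f h4.symm) h1) ?_
    rw [h2]
    exact (Matrix.zero_mulVec _).trans (map_zero f).symm
  exact one_ne_zero (congr_fun h3 ⟨0, hd i⟩)

/-- The diagonal matrix units sum to `1`, so one of them, with index `k` in a factor `i`, has a
nonzero vector `w` in its image. Letting the matrix with `k`-th column `u` and zeros elsewhere act
on `w` gives an intertwiner in `u`, which is bijective by Schur's lemma. -/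
theorem exists_matrixIrrep_equiv [Fintype ι] (hd : ∀ i, 0 < d i) (π : AlgIrrep A) :
    ∃ i, (algIrrepSetoid A).r (matrixIrrep e hd i) π := by
  have h1 : ∃ i k, π.rep (ofComponent e i (Matrix.single k k 1)) ≠ 0 := by
    by_contra! h
    have h2 : π.rep 1 = 0 := by
      rw [← sum_ofComponent e, map_sum]
      exact Finset.sum_eq_zero fun i _ => by
        rw [map_sum]
        exact Finset.sum_eq_zero fun k _ => h i k
    rw [map_one] at h2
    exact one_ne_zero (congr_fun (LinearMap.congr_fun h2 fun _ => 1) ⟨0, π.dim_pos⟩)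
  obtain ⟨i, k, hik⟩ := h1
  obtain ⟨x, hx⟩ : ∃ x, π.rep (ofComponent e i (Matrix.single k k 1)) x ≠ 0 := by
    by_contra! h
    exact hik (LinearMap.ext h)
  set w := π.rep (ofComponent e i (Matrix.single k k 1)) x with hw
  let T : (Fin (d i) → ℂ) →ₗ[ℂ] (Fin π.dim → ℂ) :=
    { toFun := fun u => π.rep (ofComponent e i (Matrix.vecMulVec u (Pi.single k 1))) w
      map_add' := fun u v => by
        rw [Matrix.add_vecMulVec, ofComponent_add, map_add, LinearMap.add_apply]
      map_smul' := fun c u => by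
        rw [Matrix.smul_vecMulVec, ofComponent_smul, map_smul, LinearMap.smul_apply,
          RingHom.id_apply] }
  have hT : ∀ a (u : Fin (d i) → ℂ), T ((e a i).mulVec u) = π.rep a (T u) := by
    intro a u
    change π.rep (ofComponent e i (Matrix.vecMulVec ((e a i).mulVec u) (Pi.single k 1))) w =
      π.rep a (π.rep (ofComponent e i (Matrix.vecMulVec u (Pi.single k 1))) w)
    rw [← Matrix.mul_vecMulVec, ← mul_ofComponent, map_mul, Module.End.mul_apply]
  have hTk : T (Pi.single k 1) = w := by
    change π.rep (ofComponent e i (Matrix.vecMulVec (Pi.single k 1) (Pi.single k 1))) w = w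
    rw [← Matrix.single_eq_single_vecMulVec_single, hw, ← Module.End.mul_apply, ← map_mul,
      mul_ofComponent, apply_ofComponent_same, Matrix.single_mul_single_same, mul_one]
  have hT0 : T ≠ 0 := fun h => hx (by rw [← hTk, h, LinearMap.zero_apply])
  have hker : LinearMap.ker T = ⊥ := by
    refine ((matrixIrrep e hd i).irreducible (LinearMap.ker T) fun a v hv => ?_).resolve_right
      fun h => hT0 (LinearMap.ker_eq_top.mp h)
    have hv' : T v = 0 := hv
    exact (hT a v).trans (by rw [hv', map_zero])
  have hrange : LinearMap.range T = ⊤ := by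
    refine (π.irreducible (LinearMap.range T) ?_).resolve_left
      fun h => hT0 (LinearMap.range_eq_bot.mp h)
    rintro a _ ⟨v, rfl⟩
    exact ⟨_, hT a v⟩
  exact ⟨i, LinearEquiv.ofBijective T ⟨LinearMap.ker_eq_bot.mp hker,
    LinearMap.range_eq_top.mp hrange⟩, fun a v => hT a v⟩

/-- The irreducible representations of a product of matrix algebras are in bijection with the
factors. -/
noncomputable def factorEquivDual [Fintype ι] (hd : ∀ i, 0 < d i) : ι ≃ AlgDual A :=
  Equiv.ofBijective (fun i => Quotient.mk (algIrrepSetoid A) (matrixIrrep e hd i))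
    ⟨fun _ _ h => eq_of_matrixIrrep_equiv e hd (Quotient.exact h), fun q => by
      induction q using Quotient.inductionOn with
      | h π =>
        obtain ⟨i, hi⟩ := exists_matrixIrrep_equiv e hd π
        exact ⟨i, Quotient.sound hi⟩⟩

include e in
theorem algZeta_eq_sum_fin [Fintype ι] (hd : ∀ i, 0 < d i) (s : ℂ) :
    algZeta A s = ∑ i, 1 / (d i : ℂ) ^ s := by
  rw [algZeta, ← (factorEquivDual e hd).tsum_eq, tsum_fintype]
  rfl

end MatrixProducts

/-- The zeta function of a product of matrix algebras. -/
theorem algZeta_eq_sum {A : Type u} [Ring A] [Algebra ℂ A] {ι : Type v} [Fintype ι]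
    {n : ι → Type w} [∀ i, Fintype (n i)] [∀ i, DecidableEq (n i)] [∀ i, Nonempty (n i)]
    (e : A ≃ₐ[ℂ] Π i, Matrix (n i) (n i) ℂ) (s : ℂ) :
    algZeta A s = ∑ i, 1 / (Fintype.card (n i) : ℂ) ^ s := by
  classical
  exact algZeta_eq_sum_fin (e.trans (AlgEquiv.piCongrRight fun i =>
    Matrix.reindexAlgEquiv ℂ ℂ (Fintype.equivFin (n i)))) (fun i => Fintype.card_pos) s

/-! ### Representations of groups and of their group algebras -/

section GroupAlgebra

variable {H : Type u} [Group H]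

theorem rep_mem_of_forall_single {V : Type*} [AddCommGroup V] [Module ℂ V]
    (f : MonoidAlgebra ℂ H →ₐ[ℂ] Module.End ℂ V) (W : Submodule ℂ V)
    (h : ∀ g : H, ∀ v ∈ W, f (MonoidAlgebra.of ℂ H g) v ∈ W) (a : MonoidAlgebra ℂ H) :
    ∀ v ∈ W, f a v ∈ W := by
  intro v hv
  induction a using MonoidAlgebra.induction_on with
  | of g => exact h g v hv
  | add a b ha hb => rw [map_add]; exact W.add_mem ha hb
  | smul c a ha => rw [map_smul]; exact W.smul_mem c ha

theorem dim_pos_of_isIrreducible (π : GroupIrrep H) : 0 < π.dim := by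
  obtain ⟨n, ρ, hρ⟩ := π
  rcases Nat.eq_zero_or_pos n with rfl | h
  · exfalso
    obtain ⟨a, b, hab⟩ := hρ.exists_pair_ne
    exact hab (Subrepresentation.toSubmodule_injective (Subsingleton.elim _ _))
  · exact h

/-- The representation of the group algebra given by a representation of the group. -/
noncomputable def GroupIrrep.toAlgIrrep (π : GroupIrrep H) : AlgIrrep (MonoidAlgebra ℂ H) where
  dim := π.dim
  rep := π.rep.asAlgebraHom
  dim_pos := dim_pos_of_isIrreducible π
  irreducible W hW := by
    have := π.irreducible
    let W' : Subrepresentation π.rep := ⟨W, fun g v hv => by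
      simpa using hW (MonoidAlgebra.of ℂ H g) v hv⟩
    rcases eq_bot_or_eq_top W' with h | h
    · exact Or.inl (congrArg Subrepresentation.toSubmodule h)
    · exact Or.inr (congrArg Subrepresentation.toSubmodule h)

/-- The representation of the group given by a representation of the group algebra. -/
noncomputable def AlgIrrep.toGroupIrrep (π : AlgIrrep (MonoidAlgebra ℂ H)) : GroupIrrep H where
  dim := π.dim
  rep := (π.rep : MonoidAlgebra ℂ H →* Module.End ℂ (Fin π.dim → ℂ)).comp (MonoidAlgebra.of ℂ H)
  irreducible := by
    have : Nonempty (Fin π.dim) := ⟨⟨0, π.dim_pos⟩⟩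
    refine { exists_pair_ne := ⟨⊥, ⊤, fun h => ?_⟩, eq_bot_or_eq_top := fun W => ?_ }
    · exact bot_ne_top (congrArg Subrepresentation.toSubmodule h)
    · refine (π.irreducible W.toSubmodule fun a v hv => ?_).imp
        (fun h => Subrepresentation.toSubmodule_injective h)
        (fun h => Subrepresentation.toSubmodule_injective h)
      exact rep_mem_of_forall_single π.rep W.toSubmodule
        (fun g v hv => W.apply_mem_toSubmodule g hv) a v hv

theorem intertwines_of_forall_single {V V' : Type*} [AddCommGroup V] [Module ℂ V]
    [AddCommGroup V'] [Module ℂ V'] (f : MonoidAlgebra ℂ H →ₐ[ℂ] Module.End ℂ V)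
    (f' : MonoidAlgebra ℂ H →ₐ[ℂ] Module.End ℂ V') (T : V →ₗ[ℂ] V')
    (h : ∀ g v, T (f (MonoidAlgebra.of ℂ H g) v) = f' (MonoidAlgebra.of ℂ H g) (T v))
    (a : MonoidAlgebra ℂ H) (v : V) : T (f a v) = f' a (T v) := by
  induction a using MonoidAlgebra.induction_on with
  | of g => exact h g v
  | add a b ha hb => simp [ha, hb]
  | smul c a ha => simp [ha]

/-- The irreducible representations of a group and of its group algebra. -/
noncomputable def groupDualEquiv (H : Type u) [Group H] :
    GroupDual H ≃ AlgDual (MonoidAlgebra ℂ H) where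
  toFun := Quotient.map GroupIrrep.toAlgIrrep (by
    rintro π τ ⟨f⟩
    refine ⟨f.toLinearEquiv, intertwines_of_forall_single _ _ f.toLinearEquiv.toLinearMap ?_⟩
    intro g v
    simp only [GroupIrrep.toAlgIrrep, Representation.asAlgebraHom_of]
    exact LinearMap.congr_fun (f.isIntertwining' g) v)
  invFun := Quotient.map AlgIrrep.toGroupIrrep (by
    rintro π τ ⟨f, hf⟩
    exact ⟨Representation.Equiv.mk f fun g => LinearMap.ext fun v => hf _ v⟩)
  left_inv q := by
    induction q using Quotient.inductionOn with
    | h π =>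
      refine Quotient.sound ⟨Representation.Equiv.mk (LinearEquiv.refl ℂ _) fun g => ?_⟩
      exact LinearMap.ext fun v => LinearMap.congr_fun (Representation.asAlgebraHom_of π.rep g) v
  right_inv q := by
    induction q using Quotient.inductionOn with
    | h π =>
      refine Quotient.sound ⟨LinearEquiv.refl ℂ _, ?_⟩
      exact intertwines_of_forall_single _ _ LinearMap.id fun g v =>
        LinearMap.congr_fun (Representation.asAlgebraHom_of π.toGroupIrrep.rep g) v

theorem groupZeta_eq_algZeta (H : Type u) [Group H] (s : ℂ) :
    groupZeta H s = algZeta (MonoidAlgebra ℂ H) s := by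
  rw [groupZeta, algZeta, ← (groupDualEquiv H).tsum_eq]
  refine tsum_congr fun q => ?_
  induction q using Quotient.inductionOn with
  | h π => rfl

end GroupAlgebra

/-! ### The number of solutions of the commutator equation -/

theorem sum_prod_ofFn {R T : Type*} [Ring R] [Fintype T] (f : T → R) (n : ℕ) :
    ∑ x : Fin n → T, (List.ofFn fun i => f (x i)).prod = (∑ t, f t) ^ n := by
  induction n with
  | zero => simp
  | succ n ih =>
    rw [← (Fin.consEquiv fun _ => T).sum_comp, Fintype.sum_prod_type, pow_succ', ← ih,
      Finset.sum_mul_sum]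
    refine Finset.sum_congr rfl fun t _ => Finset.sum_congr rfl fun x _ => ?_
    simp [List.ofFn_succ]

/-- Left multiplication acts on each of the `d i` columns separately. -/
theorem trace_mulLeft_pi {ι : Type v} [Fintype ι] [DecidableEq ι] {d : ι → ℕ}
    (x : Π i, Matrix (Fin (d i)) (Fin (d i)) ℂ) :
    LinearMap.trace ℂ _ (LinearMap.mulLeft ℂ x) = ∑ i, (d i : ℂ) * (x i).trace := by
  rw [LinearMap.trace_eq_matrix_trace ℂ
    (Pi.basis fun i => Matrix.stdBasis ℂ (Fin (d i)) (Fin (d i))), Matrix.trace, Fintype.sum_sigma]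
  refine Finset.sum_congr rfl fun i _ => ?_
  rw [Fintype.sum_prod_type, Matrix.trace, Finset.mul_sum]
  refine Finset.sum_congr rfl fun k _ => ?_
  have h : ∀ l : Fin (d i), (LinearMap.toMatrix
      (Pi.basis fun i => Matrix.stdBasis ℂ (Fin (d i)) (Fin (d i)))
      (Pi.basis fun i => Matrix.stdBasis ℂ (Fin (d i)) (Fin (d i)))
      (LinearMap.mulLeft ℂ x)).diag ⟨i, (k, l)⟩ = x i k k := by
    intro l
    rw [Matrix.diag_apply, LinearMap.toMatrix_apply, Pi.basis_apply, Pi.basis_repr,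
      Matrix.stdBasis_eq_single, LinearMap.mulLeft_apply, Pi.mul_apply, Pi.single_eq_same]
    change ((x i * Matrix.single k l 1 : Matrix (Fin (d i)) (Fin (d i)) ℂ) k l) = x i k k
    simp
  rw [Finset.sum_congr rfl fun l _ => h l]
  simp

section GroupAlgebra

variable {H : Type u} [Group H]

open Classical in
theorem trace_mulLeft_of [Fintype H] (h : H) :
    LinearMap.trace ℂ _ (LinearMap.mulLeft ℂ (MonoidAlgebra.of ℂ H h)) =
      if h = 1 then (Fintype.card H : ℂ) else 0 := by
  rw [LinearMap.trace_eq_matrix_trace ℂ (MonoidAlgebra.basis H ℂ), Matrix.trace]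
  have h1 : ∀ x : H, (LinearMap.toMatrix (MonoidAlgebra.basis H ℂ) (MonoidAlgebra.basis H ℂ)
      (LinearMap.mulLeft ℂ (MonoidAlgebra.of ℂ H h))).diag x = if h = 1 then 1 else 0 := by
    intro x
    rw [Matrix.diag_apply, LinearMap.toMatrix_apply]
    simp [MonoidAlgebra.basis, MonoidAlgebra.single_mul_single, Finsupp.single_apply]
  rw [Finset.sum_congr rfl fun x _ => h1 x]
  simp

variable {ι : Type v} {d : ι → ℕ}
  (e : MonoidAlgebra ℂ H ≃ₐ[ℂ] Π i, Matrix (Fin (d i)) (Fin (d i)) ℂ)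

/-- The matrix of a group element in an irreducible representation. -/
noncomputable def factorRep (i : ι) (h : H) : Matrix (Fin (d i)) (Fin (d i)) ℂ := e (MonoidAlgebra.of ℂ H h) i

theorem factorRep_mul (i : ι) (h k : H) :
    factorRep e i (h * k) = factorRep e i h * factorRep e i k := by
  simp only [factorRep, map_mul, Pi.mul_apply]

theorem factorRep_one (i : ι) : factorRep e i 1 = 1 := by
  simp only [factorRep, map_one, Pi.one_apply]

-- The trace of the regular representation, computed in the group basis and in the matrix factors.
open Classical in
theorem sum_mul_trace_factorRep [Fintype H] [Fintype ι] (h : H) :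
    ∑ i, (d i : ℂ) * (factorRep e i h).trace = if h = 1 then (Fintype.card H : ℂ) else 0 := by
  rw [← trace_mulLeft_of, ← LinearMap.trace_conj' _ e.toLinearEquiv, ← trace_mulLeft_pi]
  congr 1
  refine LinearMap.ext fun x => ?_
  change (fun i => e (MonoidAlgebra.of ℂ H h) i) * x = e (MonoidAlgebra.of ℂ H h * e.symm x)
  rw [map_mul, e.apply_symm_apply]

/-- The matrices of group elements span the whole factor, since `e` is surjective. -/
theorem eq_scalar_of_commute_factorRep (i : ι) (M : Matrix (Fin (d i)) (Fin (d i)) ℂ)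
    (hM : ∀ h, Commute (factorRep e i h) M) : ∃ c : ℂ, M = c • 1 := by
  classical
  have h1 : ∀ a : MonoidAlgebra ℂ H, Commute (e a i) M := by
    intro a
    induction a using MonoidAlgebra.induction_on with
    | of h => exact hM h
    | add a b ha hb => rw [map_add]; exact ha.add_left hb
    | smul c a ha => rw [map_smul]; exact ha.smul_left c
  have h2 : ∀ N, Commute N M := by
    intro N
    have := h1 (ofComponent e i N)
    rwa [apply_ofComponent_same] at this
  obtain ⟨c, hc⟩ := Matrix.mem_range_scalar_of_commute_single (M := M) fun k l _ => h2 _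
  exact ⟨c, by rw [← hc, Matrix.scalar_apply, Matrix.smul_one_eq_diagonal]⟩

/-- The sum commutes with every group element, so it is scalar, and its trace determines the scalar.
-/
theorem sum_conj_factorRep [Fintype H] (hd : ∀ i, 0 < d i) (i : ι) (M : Matrix (Fin (d i)) (Fin (d i)) ℂ) :
    ∑ h, factorRep e i h * M * factorRep e i h⁻¹ =
      ((Fintype.card H : ℂ) * M.trace / d i) • (1 : Matrix (Fin (d i)) (Fin (d i)) ℂ) := by
  have hd0 : (d i : ℂ) ≠ 0 := by exact_mod_cast (hd i).ne'
  obtain ⟨c, hc⟩ := eq_scalar_of_commute_factorRep e i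
    (∑ h, factorRep e i h * M * factorRep e i h⁻¹) (by
      intro k
      rw [Commute, SemiconjBy, Finset.mul_sum, Finset.sum_mul,
        ← Equiv.sum_comp (Equiv.mulLeft k⁻¹)
          (fun h => factorRep e i k * (factorRep e i h * M * factorRep e i h⁻¹))]
      refine Finset.sum_congr rfl fun h _ => ?_
      have h1 : factorRep e i k * factorRep e i k⁻¹ = 1 := by
        rw [← factorRep_mul, mul_inv_cancel, factorRep_one]
      simp only [Equiv.coe_mulLeft, mul_inv_rev, inv_inv, factorRep_mul, ← mul_assoc, h1, one_mul])
  have ht := congrArg Matrix.trace hc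
  have h1 : ∀ h, (factorRep e i h * M * factorRep e i h⁻¹).trace = M.trace := by
    intro h
    rw [Matrix.trace_mul_comm, ← mul_assoc, ← factorRep_mul, inv_mul_cancel, factorRep_one, one_mul]
  rw [Matrix.trace_sum, Matrix.trace_smul, Matrix.trace_one, Fintype.card_fin] at ht
  simp only [h1, Finset.sum_const, Finset.card_univ, nsmul_eq_mul, smul_eq_mul] at ht
  rw [hc, ht, mul_div_cancel_right₀ _ hd0]

/-- Schur orthogonality: `sum_conj_factorRep` for the matrix unit at `(m, k)`, read at the entry
`(m, l)` and summed over `m`. -/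
theorem sum_trace_smul_factorRep [Fintype H] (hd : ∀ i, 0 < d i) (i : ι) :
    ∑ h, (factorRep e i h).trace • factorRep e i h⁻¹ =
      ((Fintype.card H : ℂ) / d i) • (1 : Matrix (Fin (d i)) (Fin (d i)) ℂ) := by
  ext k l
  have h1 : ∀ m h, (factorRep e i h * Matrix.single m k 1 * factorRep e i h⁻¹ :
      Matrix (Fin (d i)) (Fin (d i)) ℂ) m l =
      factorRep e i h m m * factorRep e i h⁻¹ k l := by
    intro m h
    rw [mul_assoc, Matrix.mul_apply, Finset.sum_eq_single m]
    · simp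
    · intro m' _ hm'
      rw [Matrix.single_mul_apply_of_ne _ _ _ _ _ hm', mul_zero]
    · simp
  have h2 : ∀ m, ∑ h, factorRep e i h m m * factorRep e i h⁻¹ k l =
      if m = k ∧ m = l then (Fintype.card H : ℂ) / d i else 0 := by
    intro m
    have h3 := congrFun (congrFun (sum_conj_factorRep e hd i (Matrix.single m k 1)) m) l
    rw [Matrix.sum_apply] at h3
    simp only [h1] at h3
    rw [h3, Matrix.smul_apply, Matrix.one_apply]
    by_cases hmk : m = k
    · subst hmk
      by_cases hml : m = l
      · subst hml
        simp
      · simp [hml]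
    · simp [hmk, Matrix.trace_single_eq_of_ne]
  rw [Matrix.sum_apply]
  simp only [Matrix.smul_apply, Matrix.trace, Matrix.diag_apply, smul_eq_mul, Finset.sum_mul]
  rw [Finset.sum_comm]
  simp only [h2]
  rw [Matrix.one_apply]
  by_cases hkl : k = l
  · subst hkl
    simp
  · rw [if_neg hkl, mul_zero]
    refine Finset.sum_eq_zero fun m _ => if_neg ?_
    rintro ⟨rfl, rfl⟩
    exact hkl rfl

/-- Summing over `a` first averages `b` over its conjugates and leaves its trace times `b⁻¹`; the
sum over `b` is then the previous lemma. -/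
theorem sum_commutators_factorRep [Fintype H] (hd : ∀ i, 0 < d i) (i : ι) :
    ∑ ab : H × H, factorRep e i (ab.1 * ab.2 * ab.1⁻¹ * ab.2⁻¹) =
      ((Fintype.card H : ℂ) / d i) ^ 2 • (1 : Matrix (Fin (d i)) (Fin (d i)) ℂ) := by
  rw [Fintype.sum_prod_type, Finset.sum_comm]
  have h1 : ∀ b : H, ∑ a, factorRep e i (a * b * a⁻¹ * b⁻¹) =
      ((Fintype.card H : ℂ) / d i) • ((factorRep e i b).trace • factorRep e i b⁻¹) := by
    intro b
    have h2 := sum_conj_factorRep e hd i (factorRep e i b)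
    simp only [factorRep_mul]
    rw [← Finset.sum_mul, h2, smul_mul_assoc, one_mul, smul_smul]
    congr 1
    ring
  simp only [h1]
  rw [← Finset.smul_sum, sum_trace_smul_factorRep e hd, smul_smul, sq]

theorem factorRep_list_prod (i : ι) (l : List H) :
    factorRep e i l.prod = (l.map (factorRep e i)).prod := by
  induction l with
  | nil => simp [factorRep_one]
  | cons a l ih => simp [factorRep_mul, ih]

theorem sum_trace_solutions [Fintype H] (hd : ∀ i, 0 < d i) (i : ι) (g : ℕ) :
    ∑ x : Fin g → H × H, (factorRep e i
      (List.ofFn fun j => (x j).1 * (x j).2 * (x j).1⁻¹ * (x j).2⁻¹).prod).trace =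
      ((Fintype.card H : ℂ) / d i) ^ (2 * g) * d i := by
  rw [← Matrix.trace_sum]
  simp only [factorRep_list_prod, List.map_ofFn, Function.comp_def]
  rw [sum_prod_ofFn (fun ab : H × H => factorRep e i (ab.1 * ab.2 * ab.1⁻¹ * ab.2⁻¹)),
    sum_commutators_factorRep e hd, smul_pow, one_pow, ← pow_mul, Matrix.trace_smul,
    Matrix.trace_one, Fintype.card_fin, smul_eq_mul]

end GroupAlgebra

instance MonoidAlgebra.finite_complex (H : Type u) [Finite H] :
    Module.Finite ℂ (MonoidAlgebra ℂ H) :=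
  Module.Finite.of_basis (MonoidAlgebra.basis H ℂ)

/-- The group algebra of a finite group is a product of matrix algebras. -/
theorem exists_algEquiv_pi_matrix (H : Type u) [Group H] [Finite H] :
    ∃ (n : ℕ) (d : Fin n → ℕ), (∀ i, 0 < d i) ∧
      Nonempty (MonoidAlgebra ℂ H ≃ₐ[ℂ] Π i, Matrix (Fin (d i)) (Fin (d i)) ℂ) := by
  have : NeZero (Nat.card H : ℂ) := ⟨by exact_mod_cast Nat.card_pos.ne'⟩
  obtain ⟨n, d, hd, h⟩ :=
    IsSemisimpleRing.exists_algEquiv_pi_matrix_of_isAlgClosed ℂ (MonoidAlgebra ℂ H)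
  exact ⟨n, d, fun i => Nat.pos_of_ne_zero (hd i).out, h⟩

theorem cpow_two_mul_sub_two (n : ℕ) (g : ℕ) :
    (n : ℂ) ^ (2 * (g : ℂ) - 2) = (n : ℂ) ^ (2 * (g : ℤ) - 2) := by
  rw [← Complex.cpow_intCast]
  push_cast
  rfl

/-- **Frobenius' formula** for the number of solutions of `[a₁, b₁] ⋯ [a_g, b_g] = 1`. -/
theorem card_commutatorSolutions (g : ℕ) (H : Type u) [Group H] [Finite H] :
    (Nat.card (CommutatorSolutions g H) : ℂ) =
      (Nat.card H : ℂ) * (Nat.card H : ℂ) ^ (2 * (g : ℤ) - 2) *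
        groupZeta H (2 * (g : ℂ) - 2) := by
  classical
  have := Fintype.ofFinite H
  obtain ⟨n, d, hd, ⟨e⟩⟩ := exists_algEquiv_pi_matrix H
  have hH : (Fintype.card H : ℂ) ≠ 0 := by exact_mod_cast Fintype.card_ne_zero
  -- Weighted by `d i` and summed over `i`, the traces give `|H|` times the delta function at `1`,
  -- which picks out the solutions.
  have h1 : (Fintype.card H : ℂ) * Nat.card (CommutatorSolutions g H) =
      ∑ i, (d i : ℂ) * (((Fintype.card H : ℂ) / d i) ^ (2 * g) * d i) := by
    simp only [← sum_trace_solutions e hd, Finset.mul_sum]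
    rw [Finset.sum_comm]
    simp only [sum_mul_trace_factorRep]
    rw [CommutatorSolutions, Nat.card_eq_fintype_card, Fintype.card_subtype, ← Finset.sum_filter,
      Finset.sum_const, nsmul_eq_mul, mul_comm]
  apply mul_left_cancel₀ hH
  rw [h1, groupZeta_eq_algZeta, algZeta_eq_sum_fin e hd, Finset.mul_sum, Finset.mul_sum,
    Nat.card_eq_fintype_card]
  refine Finset.sum_congr rfl fun i _ => ?_
  have hd0 : (d i : ℂ) ≠ 0 := by exact_mod_cast (hd i).ne'
  rw [cpow_two_mul_sub_two, zpow_sub₀ hd0, zpow_sub₀ hH, div_pow]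
  have h2 : ∀ z : ℂ, z ^ (2 * (g : ℤ)) = z ^ (2 * g) := fun z => by
    rw [← zpow_natCast]; push_cast; rfl
  rw [h2, h2]
  have h3 : ∀ z : ℂ, z ^ (2 : ℤ) = z * z := fun z => by
    rw [show (2 : ℤ) = ((2 : ℕ) : ℤ) from rfl, zpow_natCast, sq]
  rw [h3, h3]
  field_simp

/-! ### Products of matrix algebras -/

/-- Matrices over a product of algebras. -/
def matrixPiAlgEquiv (m : Type u) [Fintype m] [DecidableEq m] {κ : Type v} (B : κ → Type w)
    [∀ i, Ring (B i)] [∀ i, Algebra ℂ (B i)] :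
    Matrix m m (Π i, B i) ≃ₐ[ℂ] Π i, Matrix m m (B i) where
  toFun M i := M.map fun b => b i
  invFun F := Matrix.of fun k l i => F i k l
  left_inv _ := rfl
  right_inv _ := rfl
  map_mul' M N := by
    funext i
    ext k l
    simp [Matrix.mul_apply]
  map_add' _ _ := rfl
  commutes' c := by
    funext i
    ext k l
    rw [Pi.algebraMap_apply, Matrix.map_apply, Matrix.algebraMap_matrix_apply,
      Matrix.algebraMap_matrix_apply]
    split_ifs <;> rfl

/-- A product over a sigma type as an iterated product. -/
def piCurryAlgEquiv {ι : Type u} {κ : ι → Type v} (B : ∀ i, κ i → Type w)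
    [∀ i j, Ring (B i j)] [∀ i j, Algebra ℂ (B i j)] :
    (Π p : Sigma κ, B p.1 p.2) ≃ₐ[ℂ] Π i j, B i j where
  __ := Equiv.piCurry B
  map_mul' _ _ := rfl
  map_add' _ _ := rfl
  commutes' _ := rfl

/-! ### The Drinfeld double as a product of matrix algebras over group algebras -/

section Double

variable {G : Type u} [Group G]

/-- The elements of a conjugacy class. -/
abbrev ConjFiber (O : ConjClasses G) : Type u := {h : G // ConjClasses.mk h = O}

theorem exists_conj_representative {ι : ConjClasses G → G}
    (hι : ∀ O : ConjClasses G, ConjClasses.mk (ι O) = O) :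
    ∃ r : G → G, ∀ h, r h * ι (ConjClasses.mk h) * (r h)⁻¹ = h := by
  have h1 : ∀ h, ∃ c, c * ι (ConjClasses.mk h) * c⁻¹ = h := fun h =>
    isConj_iff.mp (ConjClasses.mk_eq_mk_iff_isConj.mp (hι (ConjClasses.mk h)))
  choose r hr using h1
  exact ⟨r, hr⟩

variable {ι : ConjClasses G → G} {r : G → G}
  (hr : ∀ h, r h * ι (ConjClasses.mk h) * (r h)⁻¹ = h)

include hr in
theorem conj_representative {O : ConjClasses G} (h : ConjFiber O) :
    r h * ι O * (r h)⁻¹ = h := by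
  have h1 := hr h
  rwa [h.2] at h1

include hr in
-- Conjugation by `r h * c * (r k)⁻¹` takes `k` to `ι O`, fixes it, and takes it on to `h`. Such
-- products are the arrows from `k` to `h` in the conjugation groupoid.
theorem conj_mul_centralizer {O : ConjClasses G} (h k : ConjFiber O)
    (c : Subgroup.centralizer {ι O}) :
    (r h * c * (r k)⁻¹)⁻¹ * h * (r h * c * (r k)⁻¹) = k := by
  have hc : (c : G) * ι O = ι O * c := Subgroup.mem_centralizer_singleton_iff.mp c.2
  calc (r h * c * (r k)⁻¹)⁻¹ * h * (r h * c * (r k)⁻¹)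
      = (r h * c * (r k)⁻¹)⁻¹ * (r h * ι O * (r h)⁻¹) * (r h * c * (r k)⁻¹) := by
        rw [conj_representative hr h]
    _ = r k * (c : G)⁻¹ * (ι O * c) * (r k)⁻¹ := by group
    _ = k := by
        rw [← hc, ← mul_assoc, inv_mul_cancel_right, conj_representative hr k]

/-- The elements of a group as the arrows out of an object of the action groupoid of the
conjugation action. -/
def conjFiberEquiv {O : ConjClasses G} (h : ConjFiber O) :
    ConjFiber O × Subgroup.centralizer {ι O} ≃ G where
  toFun p := r h * p.2 * (r p.1)⁻¹
  invFun x :=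
    have hx : ConjClasses.mk (x⁻¹ * h * x) = O := by
      refine Eq.trans (ConjClasses.mk_eq_mk_iff_isConj.mpr (isConj_iff.mpr ⟨x, ?_⟩)) h.2
      group
    (⟨x⁻¹ * h * x, hx⟩, ⟨(r h)⁻¹ * x * r (x⁻¹ * h * x), by
      rw [Subgroup.mem_centralizer_singleton_iff]
      have h1 := conj_representative hr h
      have h2 : r (x⁻¹ * h * x) * ι O * (r (x⁻¹ * h * x))⁻¹ = x⁻¹ * h * x :=
        conj_representative hr ⟨x⁻¹ * h * x, hx⟩
      generalize r (x⁻¹ * h * x) = b at h2 ⊢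
      calc (r h)⁻¹ * x * b * ι O = (r h)⁻¹ * x * (b * ι O * b⁻¹) * b := by group
        _ = (r h)⁻¹ * h * x * b := by rw [h2]; group
        _ = (r h)⁻¹ * (r h * ι O * (r h)⁻¹) * x * b := by rw [h1]
        _ = ι O * ((r h)⁻¹ * x * b) := by group⟩)
  left_inv p := by
    have h1 := conj_mul_centralizer hr h p.1 p.2
    refine Prod.ext (Subtype.ext h1) (Subtype.ext ?_)
    simp only [h1]
    group
  right_inv x := by
    simp only
    group

theorem conjFiberEquiv_apply {O : ConjClasses G} (h k : ConjFiber O)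
    (c : Subgroup.centralizer {ι O}) :
    conjFiberEquiv hr h (k, c) = r h * c * (r k)⁻¹ := rfl

variable [Fintype G]

open Classical in
/-- The components of an element of the Drinfeld double. -/
noncomputable def doubleLinearEquiv :
    DrinfeldDouble G ≃ₗ[ℂ] Π O : ConjClasses G,
      Matrix (ConjFiber O) (ConjFiber O) (MonoidAlgebra ℂ (Subgroup.centralizer {ι O})) where
  toFun a O := Matrix.of fun h k => MonoidAlgebra.ofCoeff
    (Finsupp.equivFunOnFinite.symm fun c => a h (conjFiberEquiv hr h (k, c)))
  map_add' a b := by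
    funext O
    ext h k x
    exact DrinfeldDouble.add_apply a b h (conjFiberEquiv hr h (k, x))
  map_smul' c a := by
    funext O
    ext h k x
    exact DrinfeldDouble.smul_apply c a h (conjFiberEquiv hr h (k, x))
  invFun F h x := (F (ConjClasses.mk h) ⟨h, rfl⟩ ((conjFiberEquiv hr ⟨h, rfl⟩).symm x).1).coeff
    ((conjFiberEquiv hr ⟨h, rfl⟩).symm x).2
  left_inv a := by
    funext h x
    change a h (conjFiberEquiv hr ⟨h, rfl⟩ ((conjFiberEquiv hr ⟨h, rfl⟩).symm x)) = a h x
    rw [Equiv.apply_symm_apply]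
  right_inv F := by
    funext O
    ext h k c
    obtain ⟨h, rfl⟩ := h
    change (F (ConjClasses.mk h) ⟨h, rfl⟩ ((conjFiberEquiv hr ⟨h, rfl⟩).symm
      (conjFiberEquiv hr ⟨h, rfl⟩ (k, c))).1).coeff ((conjFiberEquiv hr ⟨h, rfl⟩).symm
      (conjFiberEquiv hr ⟨h, rfl⟩ (k, c))).2 = _
    rw [Equiv.symm_apply_apply]

theorem coeff_doubleLinearEquiv (a : DrinfeldDouble G) {O : ConjClasses G} (h k : ConjFiber O)
    (c : Subgroup.centralizer {ι O}) :
    (doubleLinearEquiv hr a O h k).coeff c = a h (r h * c * (r k)⁻¹) := rfl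

open Classical in
theorem doubleLinearEquiv_one : doubleLinearEquiv hr (1 : DrinfeldDouble G) = 1 := by
  funext O
  ext h k c
  rw [coeff_doubleLinearEquiv, DrinfeldDouble.one_apply, Pi.one_apply, Matrix.one_apply]
  by_cases hhk : h = k
  · subst hhk
    rw [if_pos rfl, MonoidAlgebra.one_def, MonoidAlgebra.coeff_single, Finsupp.single_apply]
    have h1 : r h * (c : G) * (r h)⁻¹ = 1 ↔ 1 = c := by
      rw [conj_eq_one_iff, OneMemClass.coe_eq_one, eq_comm]
    simp only [h1]
  · rw [if_neg hhk, MonoidAlgebra.coeff_zero, Finsupp.zero_apply, if_neg]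
    intro h1
    have h2 := conj_mul_centralizer hr h k c
    rw [h1] at h2
    exact hhk (Subtype.ext (by simpa using h2))

-- With `y = r h * c' * (r l)⁻¹`, conjugation gives `y⁻¹ * h * y = l`. The product in the double
-- thus splits into a matrix product over `l` and a convolution over `c'`.
open Classical in
theorem doubleLinearEquiv_mul (a b : DrinfeldDouble G) :
    doubleLinearEquiv hr (a * b) = doubleLinearEquiv hr a * doubleLinearEquiv hr b := by
  funext O
  ext h k c
  rw [coeff_doubleLinearEquiv, DrinfeldDouble.mul_apply, ← Equiv.sum_comp (conjFiberEquiv hr h),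
    Fintype.sum_prod_type, Pi.mul_apply, Matrix.mul_apply, MonoidAlgebra.coeff_sum,
    Finsupp.finsetSum_apply]
  refine Finset.sum_congr rfl fun l _ => ?_
  rw [MonoidAlgebra.coeff_mul_apply_left, Finsupp.sum_fintype _ _ fun _ => zero_mul _]
  refine Finset.sum_congr rfl fun c' _ => ?_
  rw [coeff_doubleLinearEquiv, coeff_doubleLinearEquiv, conjFiberEquiv_apply,
    conj_mul_centralizer hr]
  congr 2
  push_cast
  group

open Classical in
/-- The Drinfeld double is a product of matrix algebras over the group algebras of centralizers. -/
noncomputable def doubleAlgEquiv :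
    DrinfeldDouble G ≃ₐ[ℂ] Π O : ConjClasses G,
      Matrix (ConjFiber O) (ConjFiber O) (MonoidAlgebra ℂ (Subgroup.centralizer {ι O})) :=
  AlgEquiv.ofLinearEquiv (doubleLinearEquiv hr) (doubleLinearEquiv_one hr)
    (doubleLinearEquiv_mul hr)

end Double

/-- The number of elements of a conjugacy class. -/
theorem card_conjFiber_mul_card_centralizer {G : Type u} [Group G] {ι : ConjClasses G → G}
    (hι : ∀ O : ConjClasses G, ConjClasses.mk (ι O) = O) (O : ConjClasses G) :
    Nat.card (ConjFiber O) * Nat.card (Subgroup.centralizer {ι O}) = Nat.card G := by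
  obtain ⟨r, hr⟩ := exists_conj_representative hι
  rw [← Nat.card_prod, Nat.card_congr (conjFiberEquiv hr ⟨ι O, hι O⟩)]

/-- The zeta function of the Drinfeld double. -/
theorem algZeta_drinfeldDouble {G : Type u} [Group G] [Fintype G] [Fintype (ConjClasses G)]
    {ι : ConjClasses G → G} (hι : ∀ O : ConjClasses G, ConjClasses.mk (ι O) = O) (s : ℂ) :
    algZeta (DrinfeldDouble G) s =
      ∑ O : ConjClasses G, 1 / (Nat.card (ConjFiber O) : ℂ) ^ s *
        groupZeta (Subgroup.centralizer {ι O}) s := by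
  classical
  obtain ⟨r, hr⟩ := exists_conj_representative hι
  choose n d hd he using fun O : ConjClasses G =>
    exists_algEquiv_pi_matrix (Subgroup.centralizer {ι O})
  let e := fun O => (he O).some
  have : ∀ O : ConjClasses G, Nonempty (ConjFiber O) := fun O => ⟨⟨ι O, hι O⟩⟩
  have : ∀ O i, Nonempty (Fin (d O i)) := fun O i => ⟨⟨0, hd O i⟩⟩
  -- Each group algebra is split into matrix factors, and matrices over matrices are flattened; a
  -- factor of size `d O i` becomes one of size `|O| * d O i`.
  let E : DrinfeldDouble G ≃ₐ[ℂ] Π p : (Σ O, Fin (n O)),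
      Matrix (ConjFiber p.1 × Fin (d p.1 p.2)) (ConjFiber p.1 × Fin (d p.1 p.2)) ℂ :=
    ((doubleAlgEquiv hr).trans (AlgEquiv.piCongrRight fun O =>
      ((e O).mapMatrix.trans (matrixPiAlgEquiv (ConjFiber O)
        fun i => Matrix (Fin (d O i)) (Fin (d O i)) ℂ)).trans (AlgEquiv.piCongrRight fun i =>
          Matrix.compAlgEquiv (ConjFiber O) (Fin (d O i)) ℂ ℂ))).trans
      (piCurryAlgEquiv fun (O : ConjClasses G) (i : Fin (n O)) =>
        Matrix (ConjFiber O × Fin (d O i)) (ConjFiber O × Fin (d O i)) ℂ).symm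
  rw [algZeta_eq_sum E s, Fintype.sum_sigma]
  refine Finset.sum_congr rfl fun O _ => ?_
  rw [groupZeta_eq_algZeta, algZeta_eq_sum_fin (e O) (hd O), Finset.mul_sum]
  refine Finset.sum_congr rfl fun i _ => ?_
  rw [Fintype.card_prod, Fintype.card_fin, Nat.cast_mul, Complex.natCast_mul_natCast_cpow,
    Nat.card_eq_fintype_card, one_div_mul_one_div]

/-! ### Conjugacy classes of homomorphisms -/

section HomModConj

variable {Γ : Type v} [Group Γ] {G : Type u} [Group G]

/-- The action of a group on homomorphisms to it by conjugation. -/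
abbrev conjMulAction (Γ : Type v) [Group Γ] (G : Type u) [Group G] : MulAction G (Γ →* G) where
  smul h φ := (MulAut.conj h).toMonoidHom.comp φ
  one_smul φ := MonoidHom.ext fun γ => by
    change 1 * φ γ * 1⁻¹ = φ γ
    group
  mul_smul h k φ := MonoidHom.ext fun γ => by
    change h * k * φ γ * (h * k)⁻¹ = h * (k * φ γ * k⁻¹) * h⁻¹
    group

/-- The homomorphisms fixed under conjugation by an element are those to its centralizer. -/
def fixedByEquivHomCentralizer (k : G) :
    letI := conjMulAction Γ G
    MulAction.fixedBy (Γ →* G) k ≃ (Γ →* Subgroup.centralizer {k}) :=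
  letI := conjMulAction Γ G
  { toFun := fun φ => φ.1.codRestrict (Subgroup.centralizer {k}) fun γ => by
      have h : k * φ.1 γ * k⁻¹ = φ.1 γ := DFunLike.congr_fun φ.2 γ
      rw [Subgroup.mem_centralizer_singleton_iff]
      exact (mul_inv_eq_iff_eq_mul.mp h).symm
    invFun := fun ψ => ⟨(Subgroup.subtype _).comp ψ, MonoidHom.ext fun γ => by
      change k * (ψ γ : G) * k⁻¹ = ψ γ
      rw [mul_inv_eq_iff_eq_mul]
      exact (Subgroup.mem_centralizer_singleton_iff.mp (ψ γ).2).symm⟩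
    left_inv := fun _ => rfl
    right_inv := fun _ => rfl }

/-- **Burnside's lemma** for homomorphisms up to conjugation. -/
theorem card_homModConj_mul_card [Fintype G] [Finite (Γ →* G)] :
    Nat.card (HomModConj Γ G) * Nat.card G = ∑ k : G, Nat.card (Γ →* Subgroup.centralizer {k}) := by
  classical
  let := conjMulAction Γ G
  have := Fintype.ofFinite (Γ →* G)
  have h1 : Nat.card (HomModConj Γ G) =
      Nat.card (Quotient (MulAction.orbitRel G (Γ →* G))) := by
    -- The two relations name the conjugating element in opposite directions, hence
    -- `MulAction.mem_orbit_symm`.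
    refine Nat.card_congr (Quotient.congrRight fun φ ψ => ?_)
    rw [MulAction.orbitRel_apply, MulAction.mem_orbit_symm]
    exact exists_congr fun h => ⟨fun hh => MonoidHom.ext fun γ => (hh γ).symm,
      fun hh γ => (DFunLike.congr_fun hh γ).symm⟩
  rw [h1, Nat.card_eq_fintype_card, Nat.card_eq_fintype_card,
    ← MulAction.sum_card_fixedBy_eq_card_orbits_mul_card_group G (Γ →* G)]
  refine Finset.sum_congr rfl fun k _ => ?_
  rw [← Nat.card_eq_fintype_card]
  exact Nat.card_congr (fixedByEquivHomCentralizer k)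

end HomModConj

/-! ### Invariance under conjugation -/

theorem groupZeta_congr {H : Type u} {K : Type v} [Group H] [Group K] [Finite H] (e : H ≃* K)
    (s : ℂ) : groupZeta H s = groupZeta K s := by
  obtain ⟨n, d, hd, ⟨f⟩⟩ := exists_algEquiv_pi_matrix H
  rw [groupZeta_eq_algZeta, groupZeta_eq_algZeta, algZeta_eq_sum_fin f hd,
    algZeta_eq_sum_fin ((MonoidAlgebra.domCongr ℂ ℂ e).symm.trans f) hd]

theorem conj_mem_centralizer {G : Type u} [Group G] {c h x : G}
    (hx : x ∈ Subgroup.centralizer {h}) : c * x * c⁻¹ ∈ Subgroup.centralizer {c * h * c⁻¹} := by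
  rw [Subgroup.mem_centralizer_singleton_iff] at hx ⊢
  calc c * x * c⁻¹ * (c * h * c⁻¹) = c * (x * h) * c⁻¹ := by group
    _ = c * h * c⁻¹ * (c * x * c⁻¹) := by rw [hx]; group

/-- The centralizers of conjugate elements are isomorphic. -/
def centralizerConjEquiv {G : Type u} [Group G] (c h : G) :
    Subgroup.centralizer {h} ≃* Subgroup.centralizer {c * h * c⁻¹} where
  toFun x := ⟨c * x * c⁻¹, conj_mem_centralizer x.2⟩
  invFun x := ⟨c⁻¹ * x * c⁻¹⁻¹, by
    have h1 := conj_mem_centralizer (c := c⁻¹) x.2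
    rwa [show c⁻¹ * (c * h * c⁻¹) * c⁻¹⁻¹ = h by group] at h1⟩
  left_inv x := Subtype.ext (by simp only; group)
  right_inv x := Subtype.ext (by simp only; group)
  map_mul' x y := Subtype.ext (by simp)

/-- The sum of a class function over a group. -/
theorem sum_eq_sum_conjClasses {G : Type u} [Group G] [Fintype G] [Fintype (ConjClasses G)]
    {ι : ConjClasses G → G} (hι : ∀ O : ConjClasses G, ConjClasses.mk (ι O) = O) (F : G → ℂ)
    (hF : ∀ c h, F (c * h * c⁻¹) = F h) :
    ∑ k, F k = ∑ O : ConjClasses G, (Nat.card (ConjFiber O) : ℂ) * F (ι O) := by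
  classical
  rw [← Finset.sum_fiberwise Finset.univ ConjClasses.mk F]
  refine Finset.sum_congr rfl fun O _ => ?_
  have h1 : ∀ k ∈ Finset.univ.filter fun k : G => ConjClasses.mk k = O, F k = F (ι O) := by
    intro k hk
    have h2 : ConjClasses.mk (ι O) = ConjClasses.mk k := (hι O).trans (Finset.mem_filter.mp hk).2.symm
    obtain ⟨c, rfl⟩ := isConj_iff.mp (ConjClasses.mk_eq_mk_iff_isConj.mp h2)
    exact hF c (ι O)
  rw [Finset.sum_congr rfl h1, Finset.sum_const, nsmul_eq_mul, Nat.card_eq_fintype_card,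
    Fintype.card_subtype]

/-! ### The three equalities -/

theorem mainTheorem1 {G : Type*} [Group G] [Fintype G] [Fintype (ConjClasses G)]
    (g : ℕ) {S : Type*} [TopologicalSpace S] (hS : IsClosedOrientableSurface g S) (x : S)
    (ι : ConjClasses G → G) (hι : ∀ O : ConjClasses G, ConjClasses.mk (ι O) = O) :
    (Nat.card (HomModConj (FundamentalGroup S x) G) : ℂ) =
        ∑ k : G, (Nat.card (Subgroup.centralizer {k}) : ℂ) / (Nat.card G : ℂ) *
          (Nat.card (Subgroup.centralizer {k}) : ℂ) ^ (2 * (g : ℤ) - 2) *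
          groupZeta (Subgroup.centralizer {k}) (2 * (g : ℂ) - 2) ∧
      ∑ k : G, (Nat.card (Subgroup.centralizer {k}) : ℂ) / (Nat.card G : ℂ) *
          (Nat.card (Subgroup.centralizer {k}) : ℂ) ^ (2 * (g : ℤ) - 2) *
          groupZeta (Subgroup.centralizer {k}) (2 * (g : ℂ) - 2) =
        ∑ O : ConjClasses G, (Nat.card (Subgroup.centralizer {ι O}) : ℂ) ^ (2 * (g : ℤ) - 2) *
          groupZeta (Subgroup.centralizer {ι O}) (2 * (g : ℂ) - 2) ∧
      ∑ O : ConjClasses G, (Nat.card (Subgroup.centralizer {ι O}) : ℂ) ^ (2 * (g : ℤ) - 2) *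
          groupZeta (Subgroup.centralizer {ι O}) (2 * (g : ℂ) - 2) =
        (Nat.card G : ℂ) ^ (2 * (g : ℤ) - 2) *
          algZeta (DrinfeldDouble G) (2 * (g : ℂ) - 2) := by
  have hG : (Nat.card G : ℂ) ≠ 0 := by exact_mod_cast Nat.card_pos.ne'
  have hO : ∀ O : ConjClasses G, (Nat.card (ConjFiber O) : ℂ) *
      (Nat.card (Subgroup.centralizer {ι O}) : ℂ) = Nat.card G := fun O => by
    exact_mod_cast card_conjFiber_mul_card_centralizer hι O
  refine ⟨?_, ?_, ?_⟩
  · obtain ⟨e⟩ := hS.nonempty_hom_equiv x G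
    have : Finite (CommutatorSolutions g G) := Subtype.finite
    have : Finite (FundamentalGroup S x →* G) := Finite.of_equiv _ e.symm
    have h1 := card_homModConj_mul_card (Γ := FundamentalGroup S x) (G := G)
    apply mul_right_cancel₀ hG
    rw [← Nat.cast_mul, h1, Nat.cast_sum, Finset.sum_mul]
    refine Finset.sum_congr rfl fun k _ => ?_
    obtain ⟨f⟩ := hS.nonempty_hom_equiv x (Subgroup.centralizer {k})
    rw [Nat.card_congr f, card_commutatorSolutions]
    field_simp
  · rw [sum_eq_sum_conjClasses hι _ fun c h => by
      rw [← groupZeta_congr (centralizerConjEquiv c h),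
        ← Nat.card_congr (centralizerConjEquiv c h).toEquiv]]
    refine Finset.sum_congr rfl fun O _ => ?_
    rw [← mul_assoc, ← mul_assoc, ← mul_div_assoc, hO, div_self hG, one_mul]
  · rw [algZeta_drinfeldDouble hι, Finset.mul_sum]
    refine Finset.sum_congr rfl fun O _ => ?_
    have h1 : (Nat.card (ConjFiber O) : ℂ) ^ (2 * (g : ℤ) - 2) ≠ 0 :=
      zpow_ne_zero _ (left_ne_zero_of_mul (by rw [hO O]; exact hG))
    -- With |G| = |O| |C_ι(O)|, the power of |O| from |G|^(2g-2) cancels the |O|^(-(2g-2)) in the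
    -- zeta function of the double.
    rw [cpow_two_mul_sub_two, ← hO O, mul_zpow]
    field_simp
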